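/- Let $N\ge 1$ be an integer and $s\in(0,1)$. Let $\mathcal D^{s,2}_0(\mathbb R^N)$ be the completion of $C^\infty_0(\mathbb R^N)$ with respect to the norm whose square is $[u]^2=\int_{\mathbb R^N}\int_{\mathbb R^N}\frac{(u(x)-u(y))^2}{|x-y|^{N+2s}}\,dx\,dy$; a function $w$ is said to belong to it if there are $\varphi_n\in C^\infty_0(\mathbb R^N)$ with $[\varphi_n-w]\to0$ and $\varphi_n\to w$ almost everywhere. For $x_0\in\mathbb R^N$ and $\rho>0$ put $$\mathrm{Tail}(w,x_0,\rho)=\rho^{2s}\int_{\mathbb R^N\setminus B_\rho(x_0)}\frac{|w(x)|}{|x-x_0|^{N+2s}}\,dx .$$ There is a constant $C>0$, depending only on $N$ and $s$, with the following property. Let $U\subset\mathbb R^N$ be an open set, $x_0\in U$, $\delta\in(0,1]$, $0<r<\mathrm{dist}(x_0,\partial U)$ (where $\mathrm{dist}(x_0,\emptyset)=+\infty$), $f\in L^\infty(U)$, and let $w\in\mathcal D^{s,2}_0(\mathbb R^N)$ be a non-negative weak subsolution of $(-\Delta)^sw=f$ in $U$, i.e. $w\ge0$ a.e. in $U$ and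 $$\int_{\mathbb R^N}\int_{\mathbb R^N}\frac{(w(x)-w(y))(\varphi(x)-\varphi(y))}{|x-y|^{N+2s}}\,dx\,dy\le\int_U f\varphi\,dx\qquad\text{for all non-negative }\varphi\in C^\infty_0(U).$$ Then $$\operatorname*{ess\,sup}_{B_{r/2}(x_0)}w\le C\left[\delta\,\mathrm{Tail}(w,x_0,r/2)+\delta\,r^{2s}\|f\|_{L^\infty(U)}+\left(\frac1\delta\right)^{\frac{N}{4s}}\left(\frac{1}{|B_r(x_0)|}\int_{B_r(x_0)}w^2\,dx\right)^{\frac12}\right].$$ -/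

import Mathlib

open MeasureTheory Metric Filter Topology
open scoped ENNReal ContDiff

noncomputable section

/-- The singular kernel `|x - y|^{-(N+2s)}` of the fractional Laplacian on `ℝ^N`. -/
def fracKernel {N : ℕ} (s : ℝ) (x y : EuclideanSpace ℝ (Fin N)) : ℝ :=
  (‖x - y‖ ^ ((N : ℝ) + 2 * s))⁻¹

/-- The double integral `∫∫ (u(x) - u(y))² / |x - y|^{N+2s} dx dy`, with values in `[0, ∞]`. -/
def gagliardoEnergy {N : ℕ} (s : ℝ) (u : EuclideanSpace ℝ (Fin N) → ℝ) : ℝ≥0∞ :=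
  ∫⁻ p : EuclideanSpace ℝ (Fin N) × EuclideanSpace ℝ (Fin N),
    ENNReal.ofReal ((u p.1 - u p.2) ^ 2 * fracKernel s p.1 p.2)

/-- The bilinear form
`∫∫ (u(x) - u(y)) (φ(x) - φ(y)) / |x - y|^{N+2s} dx dy`. -/
def gagliardoForm {N : ℕ} (s : ℝ) (u φ : EuclideanSpace ℝ (Fin N) → ℝ) : ℝ :=
  ∫ p : EuclideanSpace ℝ (Fin N) × EuclideanSpace ℝ (Fin N),
    (u p.1 - u p.2) * (φ p.1 - φ p.2) * fracKernel s p.1 p.2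

/-- `φ ∈ C^∞_0(U)`: smooth functions with compact support contained in `U`. -/
def IsTestFunction {N : ℕ} (U : Set (EuclideanSpace ℝ (Fin N)))
    (φ : EuclideanSpace ℝ (Fin N) → ℝ) : Prop :=
  ContDiff ℝ ∞ φ ∧ HasCompactSupport φ ∧ tsupport φ ⊆ U

/-- The function `w` belongs to `D_0^{s,2}(ℝ^N)`, the completion of `C^∞_0(ℝ^N)` in the norm given
by the square root of `gagliardoEnergy`: it is the limit, in that norm and almost everywhere, of a
sequence of test functions. (Energy convergence alone would determine `w` only up to an additive
constant; the almost everywhere convergence selects the element of the completion.) -/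
def MemHomogeneousSobolev {N : ℕ} (s : ℝ) (w : EuclideanSpace ℝ (Fin N) → ℝ) : Prop :=
  ∃ φ : ℕ → EuclideanSpace ℝ (Fin N) → ℝ,
    (∀ n, IsTestFunction Set.univ (φ n)) ∧
    Tendsto (fun n => gagliardoEnergy s (φ n - w)) atTop (𝓝 0) ∧
    ∀ᵐ x, Tendsto (fun n => φ n x) atTop (𝓝 (w x))

/-- `w ∈ D_0^{s,2}(ℝ^N)` is a weak subsolution of `(-Δ)^s w = f` in `U`. -/
def IsWeakSubsolution {N : ℕ} (s : ℝ) (U : Set (EuclideanSpace ℝ (Fin N)))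
    (f w : EuclideanSpace ℝ (Fin N) → ℝ) : Prop :=
  MemHomogeneousSobolev s w ∧
    ∀ φ : EuclideanSpace ℝ (Fin N) → ℝ, IsTestFunction U φ → (∀ x, 0 ≤ φ x) →
      gagliardoForm s w φ ≤ ∫ x in U, f x * φ x

/-- The nonlocal tail
`Tail(w, x₀, ρ) = ρ^{2s} ∫_{ℝ^N ∖ B_ρ(x₀)} |w(x)| / |x - x₀|^{N+2s} dx`, with values in `[0, ∞]`. -/
def nonlocalTail {N : ℕ} (s : ℝ) (w : EuclideanSpace ℝ (Fin N) → ℝ)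
    (x₀ : EuclideanSpace ℝ (Fin N)) (ρ : ℝ) : ℝ≥0∞ :=
  ENNReal.ofReal (ρ ^ (2 * s)) *
    ∫⁻ x in (ball x₀ ρ)ᶜ, ENNReal.ofReal (|w x| * fracKernel s x x₀)

end

/-
Testing the equation with `η² (w - k)⁺` gives a Caccioppoli inequality: the Gagliardo energy of
`η (w - k)⁺` is bounded by a multiple of the mass of `(w - k)⁺` near the support of the cutoff `η`,
the multiple being a power of the radius plus `‖f‖ / k` plus the tail divided by `k`. The fractional
Sobolev inequality in Faber–Krahn form (the `L²` norm is bounded by the energy times a positive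
power of the measure of the support) and Chebyshev's inequality turn this into a superlinear
recursion for the mass of `(w - kₙ)⁺` on the balls `B(x₀, (r / 2) (1 + 2⁻ⁿ))`, where
`kₙ = l (1 - 2⁻ⁿ)`. The iterates tend to zero, that is `w ≤ l` on the half ball, once the initial
mass is small compared with `l²`. Asking in addition that `l` dominates `δ Tail + δ r^{2s} ‖f‖`
makes the multiple of order `r^{-2s} / δ`, and this loss is the factor `δ^{-N/(4s)}` of the
estimate.
-/

theorem abs_mul_sub_mul_le_abs_sub_add {a b c d : ℝ} (ha : a ∈ Set.Icc 0 1) (hb : b ∈ Set.Icc 0 1)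
    (hc : 0 ≤ c) (hd : 0 ≤ d) :
    |a * c - b * d| ≤ |c - d| + min c d * |a - b| := by
  wlog h : c ≤ d generalizing a b c d
  · simpa only [abs_sub_comm, min_comm] using this hb ha hd hc (le_of_not_ge h)
  calc |a * c - b * d| = |b * (c - d) + c * (a - b)| := by ring_nf
    _ ≤ |b * (c - d)| + |c * (a - b)| := abs_add_le _ _
    _ ≤ |c - d| + min c d * |a - b| := by
        rw [abs_mul, abs_mul, abs_of_nonneg hb.1, abs_of_nonneg hc, min_eq_left h]
        gcongr
        exact mul_le_of_le_one_left (abs_nonneg _) hb.2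

section Convergence

variable {α : Type*} [MeasurableSpace α] {μ : Measure α}

/- Clipping `h n` at level `F` costs at most `d n`, which vanishes in the limit both pointwise and
in `L¹`; the clipped sequence is dominated by `F`. -/
theorem tendsto_integral_of_abs_le_add {h d : ℕ → α → ℝ} {g F : α → ℝ}
    (hm : ∀ n, AEStronglyMeasurable (h n) μ) (hF : Integrable F μ) (hd : ∀ n, Integrable (d n) μ)
    (hF0 : ∀ a, 0 ≤ F a) (hd0 : ∀ n a, 0 ≤ d n a)
    (hle : ∀ n a, |h n a| ≤ F a + d n a)
    (hd_int : Tendsto (fun n => ∫ a, d n a ∂μ) atTop (𝓝 0))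
    (hd_ae : ∀ᵐ a ∂μ, Tendsto (fun n => d n a) atTop (𝓝 0))
    (hlim : ∀ᵐ a ∂μ, Tendsto (fun n => h n a) atTop (𝓝 (g a))) :
    Tendsto (fun n => ∫ a, h n a ∂μ) atTop (𝓝 (∫ a, g a ∂μ)) := by
  set c : ℕ → α → ℝ := fun n a => max (-F a) (min (F a) (h n a)) with hc
  have hcF : ∀ n a, |c n a| ≤ F a := fun n a => by
    simp only [hc, abs_le]
    grind
  have hhc : ∀ n a, |h n a - c n a| ≤ d n a := fun n a => by
    have := abs_le.1 (hle n a)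
    simp only [hc, abs_le]
    grind
  have hcm : ∀ n, AEStronglyMeasurable (c n) μ := fun n =>
    hF.1.neg.sup (hF.1.inf (hm n))
  have hhc_int : ∀ n, Integrable (fun a => h n a - c n a) μ := fun n =>
    (hd n).mono' ((hm n).sub (hcm n)) (Eventually.of_forall (hhc n))
  have hc_int : ∀ n, Integrable (c n) μ := fun n =>
    hF.mono' (hcm n) (Eventually.of_forall (hcF n))
  have hc_lim : Tendsto (fun n => ∫ a, c n a ∂μ) atTop (𝓝 (∫ a, g a ∂μ)) := by
    refine tendsto_integral_of_dominated_convergence F hcm hF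
      (fun n => Eventually.of_forall (hcF n)) ?_
    filter_upwards [hlim, hd_ae] with a ha hda
    have hdiff : Tendsto (fun n => h n a - c n a) atTop (𝓝 0) :=
      squeeze_zero_norm (fun n => hhc n a) hda
    simpa using ha.sub hdiff
  have herr : Tendsto (fun n => ∫ a, (h n a - c n a) ∂μ) atTop (𝓝 0) :=
    squeeze_zero_norm (fun n => (norm_integral_le_integral_norm _).trans
      (integral_mono (hhc_int n).norm (hd n) (hhc n))) hd_int
  have hsum := hc_lim.add herr
  simp only [add_zero] at hsum
  refine hsum.congr fun n => ?_
  rw [← integral_add (hc_int n) (hhc_int n)]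
  simp

theorem tendsto_integral_abs_mul_of_tendsto_eLpNorm {f : α → ℝ} {g : ℕ → α → ℝ}
    (hf : MemLp f 2 μ) (hg : ∀ n, MemLp (g n) 2 μ)
    (hlim : Tendsto (fun n => eLpNorm (g n) 2 μ) atTop (𝓝 0)) :
    Tendsto (fun n => ∫ a, |f a * g n a| ∂μ) atTop (𝓝 0) := by
  have hbound : ∀ n, eLpNorm (f • g n) 1 μ ≤ eLpNorm f 2 μ * eLpNorm (g n) 2 μ := fun n =>
    eLpNorm_smul_le_mul_eLpNorm (p := 2) (q := 2) (hg n).1 hf.1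
  have hnorm : ∀ n, ∫ a, |f a * g n a| ∂μ = (eLpNorm (f • g n) 1 μ).toReal := fun n => by
    rw [eLpNorm_one_eq_lintegral_enorm, ← integral_norm_eq_lintegral_enorm (hf.1.smul (hg n).1)]
    simp only [Pi.smul_apply', smul_eq_mul, Real.norm_eq_abs]
  simp only [hnorm]
  rw [← ENNReal.toReal_zero]
  refine (ENNReal.tendsto_toReal ENNReal.zero_ne_top).comp ?_
  refine tendsto_of_tendsto_of_tendsto_of_le_of_le tendsto_const_nhds ?_ (fun _ => zero_le) hbound
  simpa using ENNReal.Tendsto.const_mul hlim (Or.inr hf.2.ne)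

theorem lintegral_ofReal_le_of_le_add {g H R : α → ℝ} (hH : Integrable H μ)
    (hR : AEMeasurable R μ) (hg0 : ∀ a, 0 ≤ g a) (hR0 : ∀ a, 0 ≤ R a) (hle : ∀ a, g a ≤ H a + R a) :
    ∫⁻ a, ENNReal.ofReal (g a) ∂μ
      ≤ ENNReal.ofReal (∫ a, H a ∂μ) + ∫⁻ a, ENNReal.ofReal (R a) ∂μ := by
  obtain hRtop | hRtop := eq_or_ne (∫⁻ a, ENNReal.ofReal (R a) ∂μ) ⊤
  · simp [hRtop]
  have hRi : Integrable R μ :=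
    (lintegral_ofReal_ne_top_iff_integrable hR.aestronglyMeasurable
      (Eventually.of_forall hR0)).1 hRtop
  calc ∫⁻ a, ENNReal.ofReal (g a) ∂μ ≤ ∫⁻ a, ENNReal.ofReal (H a + R a) ∂μ :=
        lintegral_mono fun a => ENNReal.ofReal_le_ofReal (hle a)
    _ = ENNReal.ofReal (∫ a, (H a + R a) ∂μ) :=
        (ofReal_integral_eq_lintegral_ofReal (hH.add hRi)
          (Eventually.of_forall fun a => (hg0 a).trans (hle a))).symm
    _ ≤ _ := by
        rw [integral_add hH hRi, ← ofReal_integral_eq_lintegral_ofReal hRi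
          (Eventually.of_forall hR0)]
        exact ENNReal.ofReal_add_le

end Convergence

theorem le_pow_mul_of_superlinear_recursion {Y : ℕ → ℝ≥0∞} {A B q : ℝ≥0∞} {β : ℝ}
    (hβ : 0 ≤ β) (hstep : ∀ n, Y (n + 1) ≤ A * B ^ n * Y n ^ β * Y n)
    (hq : A * Y 0 ^ β ≤ q) (hBq : B * q ^ β ≤ 1) (n : ℕ) :
    Y n ≤ q ^ n * Y 0 := by
  induction n with
  | zero => simp
  | succ n ih =>
    calc Y (n + 1) ≤ A * B ^ n * Y n ^ β * Y n := hstep n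
      _ ≤ A * B ^ n * (q ^ n * Y 0) ^ β * (q ^ n * Y 0) := by gcongr
      _ = (A * Y 0 ^ β) * (B * q ^ β) ^ n * (q ^ n * Y 0) := by
        rw [ENNReal.mul_rpow_of_nonneg _ _ hβ, mul_pow, ← ENNReal.rpow_natCast_mul,
          ← ENNReal.rpow_mul_natCast, mul_comm β]
        ring
      _ ≤ q * 1 ^ n * (q ^ n * Y 0) := by gcongr
      _ = q ^ (n + 1) * Y 0 := by ring

section SmoothClamp

theorem abs_sqrt_sq_add_sq_sub_le (a b ε : ℝ) :
    |√(a ^ 2 + ε ^ 2) - √(b ^ 2 + ε ^ 2)| ≤ |a - b| := by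
  have hnorm : ∀ t : ℝ, ‖(⟨t, ε⟩ : ℂ)‖ = √(t ^ 2 + ε ^ 2) := fun t => by
    rw [Complex.norm_eq_sqrt_sq_add_sq]
  have hsub : (⟨a, ε⟩ - ⟨b, ε⟩ : ℂ) = ((a - b : ℝ) : ℂ) := by
    apply Complex.ext <;> simp
  simpa only [hnorm, hsub, Complex.norm_real, Real.norm_eq_abs] using
    abs_norm_sub_norm_le (⟨a, ε⟩ : ℂ) ⟨b, ε⟩

/-- The clamp `t ↦ min t⁺ M`, written as `(|t| - |t - M| + M) / 2` and smoothed by replacing `|t|`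
with `√(t² + ε²)`. -/
noncomputable def smoothClamp (M ε t : ℝ) : ℝ :=
  (√(t ^ 2 + ε ^ 2) - √((t - M) ^ 2 + ε ^ 2) + M) / 2

variable {M : ℝ}

theorem smoothClamp_mem_Icc (hM : 0 ≤ M) (ε t : ℝ) : smoothClamp M ε t ∈ Set.Icc 0 M := by
  have h := abs_le.1 (abs_sqrt_sq_add_sq_sub_le t (t - M) ε)
  rw [sub_sub_cancel, abs_of_nonneg hM] at h
  constructor <;> unfold smoothClamp <;> linarith

theorem abs_smoothClamp_sub_le (M ε t u : ℝ) :
    |smoothClamp M ε t - smoothClamp M ε u| ≤ |t - u| := by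
  have h₁ := abs_le.1 (abs_sqrt_sq_add_sq_sub_le t u ε)
  have h₂ := abs_le.1 (abs_sqrt_sq_add_sq_sub_le (t - M) (u - M) ε)
  rw [sub_sub_sub_cancel_right] at h₂
  unfold smoothClamp
  exact abs_le.2 ⟨by linarith, by linarith⟩

theorem contDiff_smoothClamp (M : ℝ) {ε : ℝ} (hε : ε ≠ 0) {n : WithTop ℕ∞} :
    ContDiff ℝ n (smoothClamp M ε) := by
  have hsqrt : ∀ a : ℝ, ContDiff ℝ n fun t : ℝ => √((t - a) ^ 2 + ε ^ 2) := fun a =>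
    ContDiff.sqrt (by fun_prop) fun t => by positivity
  unfold smoothClamp
  simpa only [sub_zero] using (((hsqrt 0).sub (hsqrt M)).add contDiff_const).div_const 2

theorem smoothClamp_zero (hM : 0 ≤ M) (t : ℝ) : smoothClamp M 0 t = min t⁺ M := by
  simp only [smoothClamp, zero_pow two_ne_zero, add_zero, Real.sqrt_sq_eq_abs, posPart_def]
  grind

theorem tendsto_smoothClamp (hM : 0 ≤ M) {ε t : ℕ → ℝ} {t₀ : ℝ}
    (hε : Tendsto ε atTop (𝓝 0)) (ht : Tendsto t atTop (𝓝 t₀)) :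
    Tendsto (fun n => smoothClamp M (ε n) (t n)) atTop (𝓝 (min t₀⁺ M)) := by
  have hcont : Continuous fun p : ℝ × ℝ => smoothClamp M p.1 p.2 := by
    unfold smoothClamp
    fun_prop
  have hlim := hcont.continuousAt.tendsto.comp (hε.prodMk_nhds ht)
  rwa [smoothClamp_zero hM] at hlim

end SmoothClamp

section Cutoff

theorem exists_lipschitzWith_smoothTransition :
    ∃ L : NNReal, LipschitzWith L Real.smoothTransition := by
  obtain ⟨L, hL⟩ := (Real.smoothTransition.contDiff (n := 1)).contDiffOn.exists_lipschitzOnWith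
    one_ne_zero (convex_Icc (0 : ℝ) 1) isCompact_Icc
  refine ⟨L, LipschitzWith.of_dist_le_mul fun t u => ?_⟩
  rw [← Real.smoothTransition.projIcc (x := t), ← Real.smoothTransition.projIcc (x := u)]
  refine (hL.dist_le_mul _ (Subtype.prop _) _ (Subtype.prop _)).trans ?_
  gcongr
  exact ((LipschitzWith.projIcc zero_le_one).dist_le_mul t u).trans_eq (one_mul _)

variable {E : Type*} [NormedAddCommGroup E] [InnerProductSpace ℝ E]

theorem contDiff_smoothTransition_sub_norm (x₀ : E) {ρ R : ℝ} (hρ : 0 < ρ) (hR : ρ < R) :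
    ContDiff ℝ ∞ fun x => Real.smoothTransition ((R - ‖x - x₀‖) / (R - ρ)) := by
  refine contDiff_iff_contDiffAt.2 fun x => ?_
  obtain rfl | hx := eq_or_ne x x₀
  · have hone : (fun _ => 1) =ᶠ[𝓝 x]
        fun y => Real.smoothTransition ((R - ‖y - x‖) / (R - ρ)) := by
      filter_upwards [ball_mem_nhds x hρ] with y hy
      rw [mem_ball, dist_eq_norm] at hy
      exact (Real.smoothTransition.one_of_one_le
        ((one_le_div (sub_pos.2 hR)).2 (by linarith))).symm
    exact contDiffAt_const.congr_of_eventuallyEq hone.symm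
  · have hnorm : ContDiffAt ℝ ∞ (fun y => ‖y - x₀‖) x :=
      (contDiffAt_id.sub contDiffAt_const).norm ℝ (sub_ne_zero.2 hx)
    exact Real.smoothTransition.contDiffAt.comp x ((contDiffAt_const.sub hnorm).div_const _)

theorem exists_smooth_cutoff :
    ∃ L : ℝ, 0 < L ∧ ∀ (x₀ : E) (ρ R : ℝ), 0 < ρ → ρ < R → ∃ η : E → ℝ,
      ContDiff ℝ ∞ η ∧ (∀ x, η x ∈ Set.Icc 0 1) ∧ (∀ x ∈ ball x₀ ρ, η x = 1) ∧
      Function.support η ⊆ ball x₀ R ∧ ∀ x y, |η x - η y| ≤ L / (R - ρ) * ‖x - y‖ := by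
  obtain ⟨L, hL⟩ := exists_lipschitzWith_smoothTransition
  refine ⟨L + 1, by positivity, fun x₀ ρ R hρ hR =>
    ⟨fun x => Real.smoothTransition ((R - ‖x - x₀‖) / (R - ρ)),
      contDiff_smoothTransition_sub_norm x₀ hρ hR,
      fun x => ⟨Real.smoothTransition.nonneg _, Real.smoothTransition.le_one _⟩,
      fun x hx => ?_, fun x hx => ?_, fun x y => ?_⟩⟩
  all_goals have hd : 0 < R - ρ := sub_pos.2 hR
  · rw [mem_ball, dist_eq_norm] at hx
    exact Real.smoothTransition.one_of_one_le ((one_le_div hd).2 (by linarith))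
  · rw [mem_ball, dist_eq_norm]
    by_contra! h
    exact hx (Real.smoothTransition.zero_of_nonpos
      (div_nonpos_of_nonpos_of_nonneg (sub_nonpos.2 h) hd.le))
  · have hnorm : |‖y - x₀‖ - ‖x - x₀‖| ≤ ‖x - y‖ := by
      simpa [norm_sub_rev] using abs_norm_sub_norm_le (y - x₀) (x - x₀)
    calc _ ≤ L * |(R - ‖x - x₀‖) / (R - ρ) - (R - ‖y - x₀‖) / (R - ρ)| := hL.dist_le_mul _ _
      _ = L * (|‖y - x₀‖ - ‖x - x₀‖| / (R - ρ)) := by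
          rw [← sub_div, abs_div, abs_of_pos hd, sub_sub_sub_cancel_left]
      _ ≤ (L + 1) * (‖x - y‖ / (R - ρ)) := by
          gcongr
          linarith
      _ = _ := by ring

end Cutoff

theorem eLpNorm_two_sq {α : Type*} [MeasurableSpace α] (μ : Measure α) (f : α → ℝ) :
    eLpNorm f 2 μ ^ 2 = ∫⁻ a, ENNReal.ofReal (f a ^ 2) ∂μ := by
  have h := eLpNorm_nnreal_pow_eq_lintegral (μ := μ) (f := f) (p := 2) two_ne_zero
  simp only [NNReal.coe_ofNat, ENNReal.coe_ofNat, ENNReal.rpow_ofNat] at h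
  rw [h]
  refine lintegral_congr fun a => ?_
  rw [Real.enorm_eq_ofReal_abs, ← ENNReal.ofReal_pow (abs_nonneg _), sq_abs]

theorem memLp_two_iff_lintegral_sq_ne_top {α : Type*} [MeasurableSpace α] {μ : Measure α}
    {f : α → ℝ} (hf : AEStronglyMeasurable f μ) :
    MemLp f 2 μ ↔ ∫⁻ a, ENNReal.ofReal (f a ^ 2) ∂μ ≠ ⊤ := by
  rw [← eLpNorm_two_sq, ENNReal.pow_ne_top_iff, MemLp, lt_top_iff_ne_top]
  simp [hf]

theorem integrable_min_norm_sq_one_mul_rpow {E : Type*} [NormedAddCommGroup E] [NormedSpace ℝ E]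
    [FiniteDimensional ℝ E] [Nontrivial E] [MeasurableSpace E] [BorelSpace E] (μ : Measure E)
    [μ.IsAddHaarMeasure] {s : ℝ} (hs0 : 0 < s) (hs1 : s < 1) :
    Integrable (fun z : E =>
      min (‖z‖ ^ 2) 1 * (‖z‖ ^ ((Module.finrank ℝ E : ℝ) + 2 * s))⁻¹) μ := by
  set d := Module.finrank ℝ E
  have hd : 1 ≤ d := Module.finrank_pos
  rw [integrable_fun_norm_addHaar μ (f := fun t : ℝ => min (t ^ 2) 1 * (t ^ ((d : ℝ) + 2 * s))⁻¹),
    ← Set.Ioc_union_Ioi_eq_Ioi zero_le_one]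
  have hradial : ∀ t : ℝ, 0 < t →
      t ^ (d - 1) * (t ^ ((d : ℝ) + 2 * s))⁻¹ = t ^ (-1 - 2 * s) := fun t ht => by
    rw [← Real.rpow_natCast, ← Real.rpow_neg ht.le, ← Real.rpow_add ht, Nat.cast_sub hd]
    congr 1
    push_cast
    ring
  refine IntegrableOn.union ?_ ?_
  · have hint : IntegrableOn (fun t : ℝ => t ^ (1 - 2 * s)) (Set.Ioc 0 1) :=
      (intervalIntegrable_iff_integrableOn_Ioc_of_le zero_le_one).1
        (intervalIntegral.intervalIntegrable_rpow' (by linarith))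
    refine hint.congr_fun (fun t ht => ?_) measurableSet_Ioc
    obtain ⟨ht0, ht1⟩ := ht
    simp only [smul_eq_mul]
    rw [min_eq_left (pow_le_one₀ ht0.le ht1), mul_left_comm, hradial t ht0, ← Real.rpow_natCast,
      ← Real.rpow_add ht0]
    congr 1
    push_cast
    ring
  · refine (integrableOn_Ioi_rpow_of_lt (a := -1 - 2 * s) (by linarith) one_pos).congr_fun
      (fun t ht => ?_) measurableSet_Ioi
    have ht1 : (1 : ℝ) < t := ht
    simp only [smul_eq_mul]
    rw [min_eq_right (one_le_pow₀ ht1.le), mul_left_comm, hradial t (by linarith), one_mul]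

section Kernel

variable {N : ℕ} {s : ℝ}

theorem fracKernel_nonneg (x y : EuclideanSpace ℝ (Fin N)) : 0 ≤ fracKernel s x y :=
  inv_nonneg.2 (Real.rpow_nonneg (norm_nonneg _) _)

theorem fracKernel_comm (x y : EuclideanSpace ℝ (Fin N)) :
    fracKernel s x y = fracKernel s y x := by
  rw [fracKernel, fracKernel, norm_sub_rev]

@[fun_prop]
theorem measurable_fracKernel :
    Measurable fun p : EuclideanSpace ℝ (Fin N) × EuclideanSpace ℝ (Fin N) =>
      fracKernel s p.1 p.2 := by
  unfold fracKernel
  fun_prop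

theorem fracKernel_le_of_norm_sub_le (hs : 0 < s) {x y z : EuclideanSpace ℝ (Fin N)} {c : ℝ}
    (hc : 0 < c) (hz : z ≠ y) (h : ‖z - y‖ ≤ c * ‖x - y‖) :
    fracKernel s x y ≤ c ^ ((N : ℝ) + 2 * s) * fracKernel s z y := by
  have hzy : 0 < ‖z - y‖ := norm_pos_iff.2 (sub_ne_zero.2 hz)
  have hxy : 0 < ‖x - y‖ := pos_of_mul_pos_right (hzy.trans_le h) hc.le
  unfold fracKernel
  rw [← div_eq_mul_inv, le_div_iff₀ (by positivity), inv_mul_le_iff₀ (by positivity),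
    mul_comm (‖x - y‖ ^ _), ← Real.mul_rpow hc.le hxy.le]
  exact Real.rpow_le_rpow hzy.le h (by positivity)

theorem norm_sub_le_of_mem_ball_of_notMem_ball {E : Type*} [SeminormedAddCommGroup E]
    {x₀ x y : E} {ρ R : ℝ} (hR : ρ < R) (hx : x ∈ ball x₀ ρ) (hy : y ∉ ball x₀ R) :
    ‖x₀ - y‖ ≤ R / (R - ρ) * ‖x - y‖ := by
  rw [mem_ball, dist_eq_norm] at hx
  rw [mem_ball, dist_eq_norm, not_lt, norm_sub_rev] at hy
  have htri : ‖x₀ - y‖ ≤ ‖x - x₀‖ + ‖x - y‖ := by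
    rw [norm_sub_rev x x₀]
    exact norm_sub_le_norm_sub_add_norm_sub x₀ x y
  have hd : 0 < R - ρ := sub_pos.2 hR
  rw [div_mul_eq_mul_div, le_div_iff₀ hd]
  nlinarith [norm_nonneg (x - x₀)]

theorem fracKernel_le_of_mem_ball_of_notMem_ball (hs : 0 < s) {x₀ x y : EuclideanSpace ℝ (Fin N)}
    {ρ R : ℝ} (hR : ρ < R) (hx : x ∈ ball x₀ ρ) (hy : y ∉ ball x₀ R) :
    fracKernel s x y ≤ (R / (R - ρ)) ^ ((N : ℝ) + 2 * s) * fracKernel s x₀ y := by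
  have hR0 : 0 < R := (pos_of_mem_ball hx).trans hR
  refine fracKernel_le_of_norm_sub_le hs (div_pos hR0 (sub_pos.2 hR)) ?_
    (norm_sub_le_of_mem_ball_of_notMem_ball hR hx hy)
  rintro rfl
  exact hy (mem_ball_self hR0)

/-- The squared fractional gradient `|D^s η|² (x) = ∫ (η(x) - η(y))² / |x - y|^{N+2s} dy`. -/
noncomputable def fracGradSq (s : ℝ) (η : EuclideanSpace ℝ (Fin N) → ℝ)
    (x : EuclideanSpace ℝ (Fin N)) : ℝ≥0∞ :=
  ∫⁻ y, ENNReal.ofReal ((η x - η y) ^ 2 * fracKernel s x y)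

theorem sq_sub_mul_fracKernel_le {η : EuclideanSpace ℝ (Fin N) → ℝ} {L M : ℝ} (hL : 0 < L)
    (hM : 0 < M) {x y : EuclideanSpace ℝ (Fin N)} (hη : |η x - η y| ≤ min (L * ‖x - y‖) M) :
    (η x - η y) ^ 2 * fracKernel s x y ≤ M ^ 2 * (L / M) ^ ((N : ℝ) + 2 * s) *
      (min (‖(L / M) • (x - y)‖ ^ 2) 1 * (‖(L / M) • (x - y)‖ ^ ((N : ℝ) + 2 * s))⁻¹) := by
  have hc : 0 < L / M := div_pos hL hM
  have hnorm : ‖(L / M) • (x - y)‖ = L / M * ‖x - y‖ := by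
    rw [norm_smul, Real.norm_of_nonneg hc.le]
  have hsq : (η x - η y) ^ 2 ≤ M ^ 2 * min (‖(L / M) • (x - y)‖ ^ 2) 1 := by
    rw [← sq_abs, mul_min_of_nonneg _ _ (sq_nonneg M), mul_one, ← mul_pow, hnorm, ← mul_assoc,
      mul_div_cancel₀ L hM.ne']
    exact le_min (pow_le_pow_left₀ (abs_nonneg _) (hη.trans (min_le_left _ _)) 2)
      (pow_le_pow_left₀ (abs_nonneg _) (hη.trans (min_le_right _ _)) 2)
  have hker : fracKernel s x y
      = (L / M) ^ ((N : ℝ) + 2 * s) * (‖(L / M) • (x - y)‖ ^ ((N : ℝ) + 2 * s))⁻¹ := by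
    rw [hnorm, Real.mul_rpow hc.le (norm_nonneg _), mul_inv,
      mul_inv_cancel_left₀ (Real.rpow_pos_of_pos hc _).ne', fracKernel]
  calc _ ≤ (M ^ 2 * min (‖(L / M) • (x - y)‖ ^ 2) 1) * fracKernel s x y :=
        mul_le_mul_of_nonneg_right hsq (fracKernel_nonneg _ _)
    _ = _ := by
        rw [hker]
        ring

theorem exists_fracGradSq_le [NeZero N] (hs0 : 0 < s) (hs1 : s < 1) :
    ∃ C : ℝ, 0 < C ∧ ∀ (η : EuclideanSpace ℝ (Fin N) → ℝ) (L M : ℝ), 0 < L → 0 < M →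
      ∀ x, (∀ y, |η x - η y| ≤ min (L * ‖x - y‖) M) →
        fracGradSq s η x ≤ ENNReal.ofReal (C * (M ^ 2 * (L / M) ^ (2 * s))) := by
  set g : EuclideanSpace ℝ (Fin N) → ℝ :=
    fun z => min (‖z‖ ^ 2) 1 * (‖z‖ ^ ((N : ℝ) + 2 * s))⁻¹
  have hg_int : Integrable g := by
    simpa only [finrank_euclideanSpace_fin] using
      integrable_min_norm_sq_one_mul_rpow (volume : Measure (EuclideanSpace ℝ (Fin N))) hs0 hs1
  have hg0 : 0 ≤ g := fun z => by positivity
  refine ⟨(∫ z, g z) + 1, by linarith [integral_nonneg (μ := volume) hg0],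
    fun η L M hL hM x hη => ?_⟩
  set c := L / M
  have hc : 0 < c := div_pos hL hM
  have hscale : c ^ ((N : ℝ) + 2 * s) * (c ^ N)⁻¹ = c ^ (2 * s) := by
    rw [Real.rpow_add hc, Real.rpow_natCast]
    field_simp
  calc fracGradSq s η x
      ≤ ∫⁻ y, ENNReal.ofReal (M ^ 2 * c ^ ((N : ℝ) + 2 * s) * g (c • (x - y))) :=
        lintegral_mono fun y => ENNReal.ofReal_le_ofReal (sq_sub_mul_fracKernel_le hL hM (hη y))
    _ = ∫⁻ z, ENNReal.ofReal (M ^ 2 * c ^ ((N : ℝ) + 2 * s) * g (c • z)) :=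
        lintegral_sub_left_eq_self (μ := volume) (fun z : EuclideanSpace ℝ (Fin N) =>
          ENNReal.ofReal (M ^ 2 * c ^ ((N : ℝ) + 2 * s) * g (c • z))) x
    _ = ENNReal.ofReal ((∫ z, g z) * (M ^ 2 * (c ^ ((N : ℝ) + 2 * s) * (c ^ N)⁻¹))) := by
        rw [← ofReal_integral_eq_lintegral_ofReal ((hg_int.comp_smul hc.ne').const_mul _)
          (Eventually.of_forall fun z => mul_nonneg (by positivity) (hg0 _)), integral_const_mul,
          Measure.integral_comp_smul_of_nonneg volume g c (hR := hc.le), finrank_euclideanSpace_fin,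
          smul_eq_mul]
        ring_nf
    _ ≤ _ := by
        rw [hscale]
        gcongr
        linarith

end Kernel

section GagliardoMeasure

/-- The measure `|x - y|^{-(N+2s)} dx dy` on `ℝ^N × ℝ^N`: the fractional Sobolev seminorm of `u` is
the `L²` norm of `increment u` for it. -/
noncomputable def gagliardoMeasure (N : ℕ) (s : ℝ) :
    Measure (EuclideanSpace ℝ (Fin N) × EuclideanSpace ℝ (Fin N)) :=
  volume.withDensity fun p => ENNReal.ofReal (fracKernel s p.1 p.2)

/-- The difference `u(x) - u(y)` as a function of the pair `(x, y)`. -/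
def increment {α : Type*} (u : α → ℝ) (p : α × α) : ℝ :=
  u p.1 - u p.2

@[fun_prop]
theorem measurable_increment {α : Type*} [MeasurableSpace α] {u : α → ℝ} (hu : Measurable u) :
    Measurable (increment u) :=
  (hu.comp measurable_fst).sub (hu.comp measurable_snd)

theorem increment_sub {α : Type*} (u v : α → ℝ) :
    increment (u - v) = increment u - increment v := by
  funext p
  simp only [increment, Pi.sub_apply]
  ring

variable {N : ℕ} {s : ℝ} {u v η : EuclideanSpace ℝ (Fin N) → ℝ}

theorem lintegral_gagliardoMeasure
    (g : EuclideanSpace ℝ (Fin N) × EuclideanSpace ℝ (Fin N) → ℝ≥0∞) :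
    ∫⁻ p, g p ∂gagliardoMeasure N s = ∫⁻ p, ENNReal.ofReal (fracKernel s p.1 p.2) * g p :=
  lintegral_withDensity_eq_lintegral_mul_non_measurable _
    measurable_fracKernel.ennreal_ofReal (Eventually.of_forall fun _ => ENNReal.ofReal_lt_top) g

theorem gagliardoEnergy_eq_lintegral (u : EuclideanSpace ℝ (Fin N) → ℝ) :
    gagliardoEnergy s u = ∫⁻ p, ENNReal.ofReal (increment u p ^ 2) ∂gagliardoMeasure N s := by
  rw [lintegral_gagliardoMeasure, gagliardoEnergy]
  refine lintegral_congr fun p => ?_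
  rw [increment, mul_comm, ENNReal.ofReal_mul (fracKernel_nonneg _ _)]

theorem gagliardoEnergy_eq_eLpNorm_sq (u : EuclideanSpace ℝ (Fin N) → ℝ) :
    gagliardoEnergy s u = eLpNorm (increment u) 2 (gagliardoMeasure N s) ^ 2 := by
  rw [gagliardoEnergy_eq_lintegral, eLpNorm_two_sq]

theorem gagliardoForm_eq_integral (u φ : EuclideanSpace ℝ (Fin N) → ℝ) :
    gagliardoForm s u φ = ∫ p, increment u p * increment φ p ∂gagliardoMeasure N s := by
  rw [gagliardoMeasure, integral_withDensity_eq_integral_toReal_smul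
    measurable_fracKernel.ennreal_ofReal (Eventually.of_forall fun _ => ENNReal.ofReal_lt_top),
    gagliardoForm]
  refine integral_congr_ae (Eventually.of_forall fun p => ?_)
  simp only [ENNReal.toReal_ofReal (fracKernel_nonneg _ _), increment, smul_eq_mul]
  ring

theorem quasiMeasurePreserving_fst_gagliardoMeasure :
    Measure.QuasiMeasurePreserving Prod.fst (gagliardoMeasure N s) volume :=
  Measure.quasiMeasurePreserving_fst.mono_left (withDensity_absolutelyContinuous _ _)

theorem quasiMeasurePreserving_snd_gagliardoMeasure :
    Measure.QuasiMeasurePreserving Prod.snd (gagliardoMeasure N s) volume :=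
  Measure.quasiMeasurePreserving_snd.mono_left (withDensity_absolutelyContinuous _ _)

theorem increment_congr_ae (h : u =ᵐ[volume] v) :
    increment u =ᵐ[gagliardoMeasure N s] increment v := by
  filter_upwards [quasiMeasurePreserving_fst_gagliardoMeasure.ae_eq_comp h,
    quasiMeasurePreserving_snd_gagliardoMeasure.ae_eq_comp h] with p hfst hsnd
  exact congrArg₂ (· - ·) hfst hsnd

theorem ae_tendsto_increment {u : ℕ → EuclideanSpace ℝ (Fin N) → ℝ}
    (h : ∀ᵐ x, Tendsto (fun n => u n x) atTop (𝓝 (v x))) :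
    ∀ᵐ p ∂gagliardoMeasure N s, Tendsto (fun n => increment (u n) p) atTop (𝓝 (increment v p)) := by
  filter_upwards [quasiMeasurePreserving_fst_gagliardoMeasure.ae h,
    quasiMeasurePreserving_snd_gagliardoMeasure.ae h] with p hfst hsnd
  exact hfst.sub hsnd

theorem measurePreserving_swap_gagliardoMeasure :
    MeasurePreserving Prod.swap (gagliardoMeasure N s) (gagliardoMeasure N s) := by
  refine ⟨measurable_swap, Measure.ext_of_lintegral _ fun f hf => ?_⟩
  rw [lintegral_map hf measurable_swap, lintegral_gagliardoMeasure, lintegral_gagliardoMeasure,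
    Measure.volume_eq_prod, ← lintegral_prod_swap]
  refine lintegral_congr fun p => ?_
  rw [Prod.fst_swap, Prod.snd_swap, Prod.swap_swap, fracKernel_comm]

theorem lintegral_fst_mul_increment_sq {a : EuclideanSpace ℝ (Fin N) → ℝ≥0∞} (ha : Measurable a)
    (hη : Measurable η) :
    ∫⁻ p, a p.1 * ENNReal.ofReal (increment η p ^ 2) ∂gagliardoMeasure N s
      = ∫⁻ x, a x * fracGradSq s η x := by
  rw [lintegral_gagliardoMeasure, Measure.volume_eq_prod, lintegral_prod _ (by fun_prop)]
  refine lintegral_congr fun x => ?_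
  rw [fracGradSq, ← lintegral_const_mul _ (by unfold fracKernel; fun_prop)]
  refine lintegral_congr fun y => ?_
  rw [increment, ENNReal.ofReal_mul (sq_nonneg _)]
  ring

theorem memLp_fst_mul_increment {b : EuclideanSpace ℝ (Fin N) → ℝ} {A : ℝ≥0∞} (hbm : Measurable b)
    (hb : MemLp b 2) (hη : Measurable η) (hA : A ≠ ⊤) (hηA : ∀ x, fracGradSq s η x ≤ A) :
    MemLp (fun p => b p.1 * increment η p) 2 (gagliardoMeasure N s) := by
  rw [memLp_two_iff_lintegral_sq_ne_top hbm.aestronglyMeasurable] at hb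
  rw [memLp_two_iff_lintegral_sq_ne_top (by fun_prop)]
  simp only [mul_pow, ENNReal.ofReal_mul (sq_nonneg (b _))]
  rw [lintegral_fst_mul_increment_sq (a := fun x => ENNReal.ofReal (b x ^ 2)) (by fun_prop) hη]
  refine ne_top_of_le_ne_top (ENNReal.mul_ne_top hb hA) ?_
  rw [← lintegral_mul_const _ (by fun_prop)]
  gcongr with x
  exact hηA x

theorem memLp_snd_mul_increment {b : EuclideanSpace ℝ (Fin N) → ℝ} {A : ℝ≥0∞} (hbm : Measurable b)
    (hb : MemLp b 2) (hη : Measurable η) (hA : A ≠ ⊤) (hηA : ∀ x, fracGradSq s η x ≤ A) :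
    MemLp (fun p => b p.2 * increment η p) 2 (gagliardoMeasure N s) := by
  refine ((memLp_fst_mul_increment hbm hb hη hA hηA).comp_measurePreserving
    measurePreserving_swap_gagliardoMeasure).neg.ae_eq (Eventually.of_forall fun p => ?_)
  simp only [increment, Pi.neg_apply, Function.comp_apply, Prod.fst_swap, Prod.snd_swap]
  ring

end GagliardoMeasure

section Sobolev

variable {N : ℕ} {s : ℝ} {U : Set (EuclideanSpace ℝ (Fin N))}
  {f g v w φ : EuclideanSpace ℝ (Fin N) → ℝ}

theorem IsTestFunction.measurable (hφ : IsTestFunction U φ) : Measurable φ :=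
  hφ.1.continuous.measurable

theorem IsTestFunction.integrable (hφ : IsTestFunction U φ) : Integrable φ :=
  hφ.1.continuous.integrable_of_hasCompactSupport hφ.2.1

theorem IsTestFunction.mul_left (hφ : IsTestFunction U φ) (hv : ContDiff ℝ ∞ v) :
    IsTestFunction U fun x => φ x * v x :=
  ⟨hφ.1.mul hv, hφ.2.1.mul_right, (tsupport_mul_subset_left (f := φ)).trans hφ.2.2⟩

theorem IsTestFunction.exists_fracGradSq_le [NeZero N] (hs0 : 0 < s) (hs1 : s < 1)
    (hφ : IsTestFunction U φ) : ∃ A : ℝ≥0∞, A ≠ ⊤ ∧ ∀ x, fracGradSq s φ x ≤ A := by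
  obtain ⟨C, -, hC⟩ := _root_.exists_fracGradSq_le (N := N) hs0 hs1
  obtain ⟨L, hL⟩ := ContDiff.lipschitzWith_of_hasCompactSupport hφ.2.1 hφ.1 (by simp)
  obtain ⟨M, hM⟩ := hφ.2.1.exists_bound_of_continuous hφ.1.continuous
  have hM0 : 0 ≤ M := (norm_nonneg _).trans (hM 0)
  refine ⟨_, ENNReal.ofReal_ne_top, fun x =>
    hC φ (L + 1) (2 * M + 1) (by positivity) (by positivity) x fun y => le_min ?_ ?_⟩
  · refine (hL.norm_sub_le x y).trans ?_
    gcongr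
    linarith
  · refine (norm_sub_le (φ x) (φ y)).trans ?_
    linarith [hM x, hM y]

theorem IsTestFunction.memLp_increment [NeZero N] (hs0 : 0 < s) (hs1 : s < 1)
    (hφ : IsTestFunction U φ) : MemLp (increment φ) 2 (gagliardoMeasure N s) := by
  obtain ⟨A, hA, hφA⟩ := hφ.exists_fracGradSq_le hs0 hs1
  have hφm := hφ.measurable
  set b : EuclideanSpace ℝ (Fin N) → ℝ := (tsupport φ).indicator 1 with hb
  have hbm : Measurable b := measurable_one.indicator (isClosed_tsupport φ).measurableSet
  have hb2 : MemLp b 2 :=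
    memLp_indicator_const 2 (isClosed_tsupport φ).measurableSet 1
      (Or.inr hφ.2.1.isCompact.measure_lt_top.ne)
  refine MemLp.of_le ((memLp_fst_mul_increment hbm hb2 hφm hA hφA).norm.add
    (memLp_snd_mul_increment hbm hb2 hφm hA hφA).norm) (by fun_prop)
    (Eventually.of_forall fun p => ?_)
  refine le_trans ?_ (le_abs_self _)
  simp only [Pi.add_apply, norm_mul, ← add_mul]
  by_cases hp : p.1 ∈ tsupport φ ∨ p.2 ∈ tsupport φ
  · refine le_mul_of_one_le_left (norm_nonneg _) ?_
    rcases hp with hp | hp <;> simp [hb, hp]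
  · rw [not_or] at hp
    simp [increment, image_eq_zero_of_notMem_tsupport hp.1, image_eq_zero_of_notMem_tsupport hp.2]

theorem MemHomogeneousSobolev.aemeasurable (hw : MemHomogeneousSobolev s w) : AEMeasurable w := by
  obtain ⟨φ, hφ, -, hlim⟩ := hw
  exact aemeasurable_of_tendsto_metrizable_ae' (fun n => (hφ n).measurable.aemeasurable) hlim

theorem MemHomogeneousSobolev.congr_ae (hw : MemHomogeneousSobolev s w) (h : w =ᵐ[volume] v) :
    MemHomogeneousSobolev s v := by
  obtain ⟨φ, hφ, henergy, hlim⟩ := hw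
  refine ⟨φ, hφ, henergy.congr fun n => ?_, ?_⟩
  · rw [gagliardoEnergy_eq_eLpNorm_sq, gagliardoEnergy_eq_eLpNorm_sq,
      eLpNorm_congr_ae (increment_congr_ae ((EventuallyEq.refl _ (φ n)).sub h))]
  · filter_upwards [hlim, h] with x hx hwv
    rwa [← hwv]

theorem tendsto_eLpNorm_increment_of_tendsto_gagliardoEnergy
    {u : ℕ → EuclideanSpace ℝ (Fin N) → ℝ}
    (h : Tendsto (fun n => gagliardoEnergy s (u n)) atTop (𝓝 0)) :
    Tendsto (fun n => eLpNorm (increment (u n)) 2 (gagliardoMeasure N s)) atTop (𝓝 0) := by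
  have hsqrt := h.ennrpow_const (1 / 2)
  rw [ENNReal.zero_rpow_of_pos one_half_pos] at hsqrt
  refine hsqrt.congr fun n => ?_
  rw [gagliardoEnergy_eq_eLpNorm_sq, ← ENNReal.rpow_natCast, ← ENNReal.rpow_mul]
  norm_num

theorem MemHomogeneousSobolev.memLp_increment [NeZero N] (hs0 : 0 < s) (hs1 : s < 1)
    (hw : MemHomogeneousSobolev s w) : MemLp (increment w) 2 (gagliardoMeasure N s) := by
  have hwm := hw.aemeasurable
  obtain ⟨φ, hφ, henergy, -⟩ := hw
  obtain ⟨n, hn⟩ := ((tendsto_eLpNorm_increment_of_tendsto_gagliardoEnergy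
    henergy).eventually_lt_const ENNReal.zero_lt_top).exists
  have hm : AEMeasurable (increment (φ n - w)) (gagliardoMeasure N s) :=
    (((hφ n).measurable.aemeasurable.sub hwm).comp_quasiMeasurePreserving
      quasiMeasurePreserving_fst_gagliardoMeasure).sub
    (((hφ n).measurable.aemeasurable.sub hwm).comp_quasiMeasurePreserving
      quasiMeasurePreserving_snd_gagliardoMeasure)
  simpa [increment_sub] using
    ((hφ n).memLp_increment hs0 hs1).sub (⟨hm.aestronglyMeasurable, hn⟩ : MemLp _ _ _)

theorem IsWeakSubsolution.congr_ae (hw : IsWeakSubsolution s U f w) (h : w =ᵐ[volume] v) :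
    IsWeakSubsolution s U f v := by
  refine ⟨hw.1.congr_ae h, fun φ hφ hφ0 => le_of_eq_of_le ?_ (hw.2 φ hφ hφ0)⟩
  rw [gagliardoForm_eq_integral, gagliardoForm_eq_integral]
  exact integral_congr_ae ((increment_congr_ae h).symm.mul (EventuallyEq.refl _ (increment φ)))

theorem IsWeakSubsolution.mono_rhs (hw : IsWeakSubsolution s U f w)
    (hf : MemLp f ∞ (volume.restrict U)) (hg : MemLp g ∞ (volume.restrict U))
    (hfg : f ≤ᵐ[volume.restrict U] g) : IsWeakSubsolution s U g w := by
  refine ⟨hw.1, fun φ hφ hφ0 => (hw.2 φ hφ hφ0).trans ?_⟩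
  have hint : ∀ h : EuclideanSpace ℝ (Fin N) → ℝ, MemLp h ∞ (volume.restrict U) →
      Integrable (fun x => h x * φ x) (volume.restrict U) := fun h hh =>
    hφ.integrable.integrableOn.mul_of_top_right hh
  refine integral_mono_ae (hint f hf) (hint g hg) ?_
  filter_upwards [hfg] with x hx using mul_le_mul_of_nonneg_right hx (hφ0 x)

theorem IsWeakSubsolution.gagliardoForm_le_const_mul_integral {F : ℝ}
    (hw : IsWeakSubsolution s U (fun _ => F) w) (hφ : IsTestFunction U φ) (hφ0 : ∀ x, 0 ≤ φ x) :
    gagliardoForm s w φ ≤ F * ∫ x, φ x := by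
  refine (hw.2 φ hφ hφ0).trans_eq ?_
  rw [integral_const_mul, setIntegral_eq_integral_of_forall_compl_eq_zero]
  exact fun x hx => image_eq_zero_of_notMem_tsupport fun h => hx (hφ.2.2 h)

end Sobolev

section Testing

theorem abs_increment_mul_le {α : Type*} {q c u : α → ℝ} (hq : ∀ x, q x ∈ Set.Icc 0 1)
    (hc : ∀ x, 0 ≤ c x) (hcu : ∀ x y, |c x - c y| ≤ |u x - u y|) (p : α × α) :
    |increment (fun x => q x * c x) p|
      ≤ |increment u p| + min (c p.1) (c p.2) * |increment q p| :=
  (abs_mul_sub_mul_le_abs_sub_add (hq p.1) (hq p.2) (hc p.1) (hc p.2)).trans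
    (add_le_add (hcu p.1 p.2) le_rfl)

theorem abs_increment_mul_le_add_indicator {α : Type*} {q c v u : α → ℝ}
    (hq : ∀ x, q x ∈ Set.Icc 0 1) (hc : ∀ x, c x ∈ Set.Icc 0 (v x))
    (hcu : ∀ x y, |c x - c y| ≤ |u x - u y|) (p : α × α) :
    |increment (fun x => q x * c x) p| ≤ |increment u p|
      + |(Function.support q).indicator v p.1 * increment q p|
      + |(Function.support q).indicator v p.2 * increment q p| := by
  have h := abs_increment_mul_le hq (fun x => (hc x).1) hcu p
  have hv : ∀ x, 0 ≤ v x := fun x => (hc x).1.trans (hc x).2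
  have hind : ∀ x, 0 ≤ (Function.support q).indicator v x := fun x =>
    Set.indicator_nonneg (fun x _ => hv x) x
  rw [abs_mul, abs_mul, abs_of_nonneg (hind _), abs_of_nonneg (hind _), add_assoc, ← add_mul]
  by_cases hp : p.1 ∈ Function.support q ∨ p.2 ∈ Function.support q
  · refine h.trans ?_
    gcongr
    rcases hp with hp | hp
    · refine (min_le_left _ _).trans ((hc p.1).2.trans ?_)
      simpa [Set.indicator_of_mem hp] using hind p.2
    · refine (min_le_right _ _).trans ((hc p.2).2.trans ?_)
      simpa [Set.indicator_of_mem hp] using hind p.1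
  · simp only [not_or, Function.notMem_support] at hp
    simp [increment, hp.1, hp.2]

variable {N : ℕ} {s : ℝ} {U : Set (EuclideanSpace ℝ (Fin N))}
  {w q : EuclideanSpace ℝ (Fin N) → ℝ} {F k M : ℝ}

theorem tendsto_gagliardoForm_mul {φ c : ℕ → EuclideanSpace ℝ (Fin N) → ℝ}
    {c₀ : EuclideanSpace ℝ (Fin N) → ℝ}
    (hw : MemLp (increment w) 2 (gagliardoMeasure N s))
    (hφ : ∀ n, MemLp (increment (φ n)) 2 (gagliardoMeasure N s))
    (hφ_energy : Tendsto (fun n => gagliardoEnergy s (φ n - w)) atTop (𝓝 0))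
    (hφ_lim : ∀ᵐ x, Tendsto (fun n => φ n x) atTop (𝓝 (w x)))
    (hqm : Measurable q) (hq : MemLp (increment q) 2 (gagliardoMeasure N s))
    (hq01 : ∀ x, q x ∈ Set.Icc 0 1) (hcm : ∀ n, Measurable (c n))
    (hc : ∀ n x, c n x ∈ Set.Icc 0 M) (hcφ : ∀ n x y, |c n x - c n y| ≤ |φ n x - φ n y|)
    (hc_lim : ∀ᵐ x, Tendsto (fun n => c n x) atTop (𝓝 (c₀ x))) :
    Tendsto (fun n => gagliardoForm s w fun x => q x * c n x) atTop
      (𝓝 (gagliardoForm s w fun x => q x * c₀ x)) := by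
  have hdiff : ∀ n, MemLp (increment (φ n - w)) 2 (gagliardoMeasure N s) := fun n => by
    rw [increment_sub]
    exact (hφ n).sub hw
  have hdiff_lim : ∀ᵐ p ∂gagliardoMeasure N s,
      Tendsto (fun n => increment (φ n - w) p) atTop (𝓝 0) := by
    filter_upwards [ae_tendsto_increment hφ_lim] with p hp
    simpa [increment_sub] using hp.sub_const (increment w p)
  simp only [gagliardoForm_eq_integral]
  refine tendsto_integral_of_abs_le_add
    (F := fun p => |increment w p * increment w p| + M * |increment w p * increment q p|)
    (d := fun n p => |increment w p * increment (φ n - w) p|)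
    (fun n => hw.1.mul (by fun_prop))
    ((hw.integrable_mul hw).abs.add ((hw.integrable_mul hq).abs.const_mul M))
    (fun n => (hw.integrable_mul (hdiff n)).abs) (fun p => ?_) (fun n p => abs_nonneg _)
    (fun n p => ?_) (tendsto_integral_abs_mul_of_tendsto_eLpNorm hw hdiff
      (tendsto_eLpNorm_increment_of_tendsto_gagliardoEnergy hφ_energy)) ?_ ?_
  · have hM : 0 ≤ M := (hc 0 p.1).1.trans (hc 0 p.1).2
    positivity
  · have hφn : |increment (φ n) p| ≤ |increment w p| + |increment (φ n - w) p| := by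
      rw [increment_sub]
      simpa using abs_add_le (increment w p) (increment (φ n) p - increment w p)
    have hmin : min (c n p.1) (c n p.2) ≤ M := (min_le_left _ _).trans (hc n p.1).2
    have hbound : |increment (fun x => q x * c n x) p|
        ≤ |increment w p| + |increment (φ n - w) p| + M * |increment q p| :=
      (abs_increment_mul_le hq01 (fun x => (hc n x).1) (hcφ n) p).trans (by gcongr)
    simp only [abs_mul]
    nlinarith [mul_le_mul_of_nonneg_left hbound (abs_nonneg (increment w p))]
  · filter_upwards [hdiff_lim] with p hp
    simpa using (hp.const_mul (increment w p)).abs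
  · have hqc_lim : ∀ᵐ x, Tendsto (fun n => q x * c n x) atTop (𝓝 (q x * c₀ x)) := by
      filter_upwards [hc_lim] with x hx using hx.const_mul (q x)
    filter_upwards [ae_tendsto_increment hqc_lim] with p hp using hp.const_mul _

theorem IsWeakSubsolution.gagliardoForm_mul_min_posPart_le [NeZero N] (hs0 : 0 < s) (hs1 : s < 1)
    (hw : IsWeakSubsolution s U (fun _ => F) w) (hq : IsTestFunction U q)
    (hq01 : ∀ x, q x ∈ Set.Icc 0 1) (hM : 0 ≤ M) :
    gagliardoForm s w (fun x => q x * min (w x - k)⁺ M)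
      ≤ F * ∫ x, q x * min (w x - k)⁺ M := by
  obtain ⟨φ, hφ, hφ_energy, hφ_lim⟩ := hw.1
  set ε : ℕ → ℝ := fun n => 1 / ((n : ℝ) + 1)
  have hε0 : ∀ n, ε n ≠ 0 := fun n => by positivity
  set c : ℕ → EuclideanSpace ℝ (Fin N) → ℝ := fun n x => smoothClamp M (ε n) (φ n x - k)
  have hc_smooth : ∀ n, ContDiff ℝ ∞ (c n) := fun n =>
    (contDiff_smoothClamp M (hε0 n)).comp ((hφ n).1.sub contDiff_const)
  have hc_mem : ∀ n x, c n x ∈ Set.Icc 0 M := fun n x => smoothClamp_mem_Icc hM _ _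
  have hc_lim : ∀ᵐ x, Tendsto (fun n => c n x) atTop (𝓝 (min (w x - k)⁺ M)) := by
    filter_upwards [hφ_lim] with x hx
    exact tendsto_smoothClamp hM tendsto_one_div_add_atTop_nhds_zero_nat (hx.sub_const k)
  have hform := tendsto_gagliardoForm_mul (hw.1.memLp_increment hs0 hs1)
    (fun n => (hφ n).memLp_increment hs0 hs1) hφ_energy hφ_lim hq.measurable
    (hq.memLp_increment hs0 hs1) hq01 (fun n => (hc_smooth n).continuous.measurable) hc_mem
    (fun n x y => (abs_smoothClamp_sub_le _ _ _ _).trans_eq (by rw [sub_sub_sub_cancel_right]))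
    hc_lim
  have hint : Tendsto (fun n => ∫ x, q x * c n x) atTop (𝓝 (∫ x, q x * min (w x - k)⁺ M)) := by
    refine tendsto_integral_of_dominated_convergence (fun x => q x * M)
      (fun n => (hq.mul_left (hc_smooth n)).measurable.aestronglyMeasurable)
      (hq.integrable.mul_const M) (fun n => Eventually.of_forall fun x => ?_) ?_
    · rw [Real.norm_of_nonneg (mul_nonneg (hq01 x).1 (hc_mem n x).1)]
      exact mul_le_mul_of_nonneg_left (hc_mem n x).2 (hq01 x).1
    · filter_upwards [hc_lim] with x hx using hx.const_mul (q x)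
  exact le_of_tendsto_of_tendsto' hform (hint.const_mul F) fun n =>
    hw.gagliardoForm_le_const_mul_integral (hq.mul_left (hc_smooth n))
      fun x => mul_nonneg (hq01 x).1 (hc_mem n x).1

theorem abs_min_posPart_sub_le (a b M : ℝ) : |min a⁺ M - min b⁺ M| ≤ |a - b| :=
  (abs_min_sub_min_le_max _ _ _ _).trans
    (max_le (abs_max_sub_max_le_abs _ _ _) (by simp))

theorem IsTestFunction.integrable_mul_of_memLp {v : EuclideanSpace ℝ (Fin N) → ℝ}
    (hq : IsTestFunction U q) (hv : MemLp v 2 (volume.restrict (Function.support q))) :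
    Integrable (fun x => q x * v x) := by
  rw [← integrableOn_iff_integrable_of_support_subset
    (Function.support_mul_subset_left q v)]
  exact MemLp.integrable_mul (p := 2) (q := 2)
    ((hq.1.continuous.memLp_of_hasCompactSupport hq.2.1).restrict _) hv

theorem memLp_indicator_mul_increment [NeZero N] (hs0 : 0 < s) (hs1 : s < 1)
    {v : EuclideanSpace ℝ (Fin N) → ℝ} (hq : IsTestFunction U q) (hvm : Measurable v)
    (hv : MemLp v 2 (volume.restrict (Function.support q))) :
    MemLp (fun p => (Function.support q).indicator v p.1 * increment q p) 2 (gagliardoMeasure N s) ∧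
      MemLp (fun p => (Function.support q).indicator v p.2 * increment q p) 2
        (gagliardoMeasure N s) := by
  have hS : MeasurableSet (Function.support q) := measurableSet_support hq.measurable
  obtain ⟨A, hA, hqA⟩ := hq.exists_fracGradSq_le hs0 hs1
  have hb : MemLp ((Function.support q).indicator v) 2 := (memLp_indicator_iff_restrict hS).2 hv
  exact ⟨memLp_fst_mul_increment (hvm.indicator hS) hb hq.measurable hA hqA,
    memLp_snd_mul_increment (hvm.indicator hS) hb hq.measurable hA hqA⟩

theorem integrable_increment_mul_posPart [NeZero N] (hs0 : 0 < s) (hs1 : s < 1)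
    (hw : MemLp (increment w) 2 (gagliardoMeasure N s)) (hwm : Measurable w)
    (hq : IsTestFunction U q) (hq01 : ∀ x, q x ∈ Set.Icc 0 1)
    (hv : MemLp (fun x => (w x - k)⁺) 2 (volume.restrict (Function.support q))) :
    Integrable (fun p => increment w p * increment (fun x => q x * (w x - k)⁺) p)
      (gagliardoMeasure N s) := by
  have hqm := hq.measurable
  obtain ⟨hfst, hsnd⟩ := memLp_indicator_mul_increment hs0 hs1 hq (by fun_prop) hv
  refine hw.integrable_mul (((hw.abs.add hfst.abs).add hsnd.abs).mono (by fun_prop)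
    (Eventually.of_forall fun p => ?_))
  refine le_trans ?_ (le_abs_self _)
  refine abs_increment_mul_le_add_indicator hq01 (fun x => ⟨posPart_nonneg _, le_rfl⟩)
    (fun x y => (abs_max_sub_max_le_abs _ _ _).trans_eq ?_) p
  rw [sub_sub_sub_cancel_right]

theorem IsWeakSubsolution.gagliardoForm_mul_posPart_le [NeZero N] (hs0 : 0 < s) (hs1 : s < 1)
    (hw : IsWeakSubsolution s U (fun _ => F) w) (hwm : Measurable w) (hq : IsTestFunction U q)
    (hq01 : ∀ x, q x ∈ Set.Icc 0 1)
    (hv : MemLp (fun x => (w x - k)⁺) 2 (volume.restrict (Function.support q))) :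
    gagliardoForm s w (fun x => q x * (w x - k)⁺) ≤ F * ∫ x, q x * (w x - k)⁺ := by
  have hqm := hq.measurable
  have hDw := hw.1.memLp_increment hs0 hs1
  set c : ℕ → EuclideanSpace ℝ (Fin N) → ℝ := fun n x => min (w x - k)⁺ n
  have hc_mem : ∀ n x, c n x ∈ Set.Icc 0 (w x - k)⁺ := fun n x =>
    ⟨le_min (posPart_nonneg _) n.cast_nonneg, min_le_left _ _⟩
  have hqc_lim : ∀ x, Tendsto (fun n => q x * c n x) atTop (𝓝 (q x * (w x - k)⁺)) := fun x => by
    refine (tendsto_const_nhds.congr' ?_).const_mul (q x)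
    filter_upwards [tendsto_natCast_atTop_atTop.eventually_ge_atTop (w x - k)⁺] with n hn
    exact (min_eq_left hn).symm
  obtain ⟨hfst, hsnd⟩ := memLp_indicator_mul_increment hs0 hs1 hq (by fun_prop) hv
  have hform : Tendsto (fun n => gagliardoForm s w fun x => q x * c n x) atTop
      (𝓝 (gagliardoForm s w fun x => q x * (w x - k)⁺)) := by
    simp only [gagliardoForm_eq_integral]
    refine tendsto_integral_of_dominated_convergence _
      (fun n => hDw.1.mul (by fun_prop))
      (hDw.integrable_mul ((hDw.abs.add hfst.abs).add hsnd.abs)).abs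
      (fun n => Eventually.of_forall fun p => ?_) (Eventually.of_forall fun p => ?_)
    · rw [Real.norm_eq_abs, Pi.mul_apply, abs_mul, abs_mul]
      refine mul_le_mul_of_nonneg_left (le_trans ?_ (le_abs_self _)) (abs_nonneg _)
      refine abs_increment_mul_le_add_indicator hq01 (hc_mem n)
        (fun x y => (abs_min_posPart_sub_le _ _ _).trans_eq ?_) p
      rw [sub_sub_sub_cancel_right]
    · exact ((hqc_lim p.1).sub (hqc_lim p.2)).const_mul _
  have hint : Tendsto (fun n => ∫ x, q x * c n x) atTop (𝓝 (∫ x, q x * (w x - k)⁺)) := by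
    refine tendsto_integral_of_dominated_convergence _ (fun n => by fun_prop)
      (hq.integrable_mul_of_memLp hv) (fun n => Eventually.of_forall fun x => ?_)
      (Eventually.of_forall hqc_lim)
    rw [Real.norm_of_nonneg (mul_nonneg (hq01 x).1 (hc_mem n x).1)]
    exact mul_le_mul_of_nonneg_left (hc_mem n x).2 (hq01 x).1
  exact le_of_tendsto_of_tendsto' hform (hint.const_mul F) fun n =>
    hw.gagliardoForm_mul_min_posPart_le hs0 hs1 hq hq01 n.cast_nonneg

end Testing

section Caccioppoli

theorem mul_le_sq_add_sq {R : Type*} [CommSemiring R] [LinearOrder R] [IsOrderedRing R]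
    [CanonicallyOrderedAdd R] (a b : R) : a * b ≤ a ^ 2 + b ^ 2 := by
  wlog h : a ≤ b generalizing a b
  · rw [mul_comm, add_comm]
    exact this b a (le_of_not_ge h)
  rw [sq b]
  exact (mul_le_mul_left h b).trans le_add_self

theorem sq_mul_posPart_sub_le (a b c d : ℝ) :
    (c * a⁺ - d * b⁺) ^ 2 ≤ (a - b) * (c ^ 2 * a⁺ - d ^ 2 * b⁺) + a⁺ * b⁺ * (c - d) ^ 2 := by
  obtain ha | ha := le_total a 0 <;> obtain hb | hb := le_total b 0 <;>
    simp only [posPart_of_nonpos, posPart_of_nonneg, ha, hb]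
  · simp
  · nlinarith [mul_nonneg (mul_nonneg (sq_nonneg d) hb) (neg_nonneg.2 ha)]
  · nlinarith [mul_nonneg (mul_nonneg (sq_nonneg c) ha) (neg_nonneg.2 hb)]
  · exact le_of_eq (by ring)

variable {N : ℕ} {s : ℝ} {x₀ : EuclideanSpace ℝ (Fin N)} {ρ R : ℝ}

theorem setLIntegral_ball_prod_compl_ball_gagliardoMeasure_le
    {v : EuclideanSpace ℝ (Fin N) → ℝ≥0∞} (hs0 : 0 < s) (hR : ρ < R) (hv : Measurable v) :
    ∫⁻ p in ball x₀ ρ ×ˢ (ball x₀ R)ᶜ, v p.1 * v p.2 ∂gagliardoMeasure N s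
      ≤ ENNReal.ofReal ((R / (R - ρ)) ^ ((N : ℝ) + 2 * s)) * (∫⁻ x in ball x₀ ρ, v x)
        * ∫⁻ y in (ball x₀ R)ᶜ, v y * ENNReal.ofReal (fracKernel s y x₀) := by
  have hmeas : MeasurableSet (ball x₀ ρ ×ˢ (ball x₀ R)ᶜ) :=
    measurableSet_ball.prod measurableSet_ball.compl
  set c : ℝ≥0∞ := ENNReal.ofReal ((R / (R - ρ)) ^ ((N : ℝ) + 2 * s)) with hc
  have hker : ∀ p ∈ ball x₀ ρ ×ˢ (ball x₀ R)ᶜ,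
      ENNReal.ofReal (fracKernel s p.1 p.2) ≤ c * ENNReal.ofReal (fracKernel s p.2 x₀) := by
    rintro p ⟨hp₁, hp₂⟩
    rw [hc, ← ENNReal.ofReal_mul' (fracKernel_nonneg _ _), fracKernel_comm p.2]
    exact ENNReal.ofReal_le_ofReal (fracKernel_le_of_mem_ball_of_notMem_ball hs0 hR hp₁ hp₂)
  calc _ = ∫⁻ p in ball x₀ ρ ×ˢ (ball x₀ R)ᶜ,
        ENNReal.ofReal (fracKernel s p.1 p.2) * (v p.1 * v p.2) := by
        rw [gagliardoMeasure, setLIntegral_withDensity_eq_setLIntegral_mul _ (by fun_prop)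
          (by fun_prop) hmeas]
        rfl
    _ ≤ ∫⁻ p in ball x₀ ρ ×ˢ (ball x₀ R)ᶜ,
        (c * v p.1) * (v p.2 * ENNReal.ofReal (fracKernel s p.2 x₀)) := by
        refine setLIntegral_mono' hmeas fun p hp => ?_
        calc _ ≤ c * ENNReal.ofReal (fracKernel s p.2 x₀) * (v p.1 * v p.2) := by
              gcongr
              exact hker p hp
          _ = _ := by ring
    _ = _ := by
        rw [Measure.volume_eq_prod, ← Measure.prod_restrict,
          lintegral_prod_mul (f := fun x => c * v x)
            (g := fun y => v y * ENNReal.ofReal (fracKernel s y x₀)) (by fun_prop) (by fun_prop),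
          lintegral_const_mul _ hv]

variable {η : EuclideanSpace ℝ (Fin N) → ℝ}

theorem mul_mul_increment_sq_le {α : Type*} {η : α → ℝ} {v : α → ℝ≥0∞} {g : α × α → ℝ≥0∞}
    {S T : Set α} (hST : S ⊆ T) (hη01 : ∀ x, η x ∈ Set.Icc 0 1) (hηS : Function.support η ⊆ S)
    (hnear : ∀ p : α × α, p.1 ∈ T → v p.1 ^ 2 * ENNReal.ofReal (increment η p ^ 2) ≤ g p)
    (hfar : ∀ p : α × α, p.1 ∈ S → p.2 ∉ T → v p.1 * v p.2 ≤ g p) (p : α × α) :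
    v p.1 * v p.2 * ENNReal.ofReal (increment η p ^ 2) ≤ g p + g p.swap := by
  have hout : ∀ x, x ∉ S → η x = 0 := fun x hx => Function.notMem_support.1 fun h => hx (hηS h)
  have hswap : ∀ p : α × α, increment η p.swap ^ 2 = increment η p ^ 2 := fun p => by
    simp only [increment, Prod.fst_swap, Prod.snd_swap]
    ring
  have hle_one : ∀ p, ENNReal.ofReal (increment η p ^ 2) ≤ 1 := fun p => by
    refine ENNReal.ofReal_le_one.2 ((sq_le_one_iff_abs_le_one _).2 (abs_le.2 ⟨?_, ?_⟩)) <;>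
      simp only [increment] <;> linarith [(hη01 p.1).1, (hη01 p.1).2, (hη01 p.2).1, (hη01 p.2).2]
  have hcross : ∀ p : α × α, p.2 ∉ T →
      v p.1 * v p.2 * ENNReal.ofReal (increment η p ^ 2) ≤ g p := fun p hp₂ => by
    by_cases hp₁ : p.1 ∈ S
    · exact (mul_le_of_le_one_right' (hle_one p)).trans (hfar p hp₁ hp₂)
    · simp [increment, hout _ hp₁, hout _ fun h => hp₂ (hST h)]
  by_cases hp₂ : p.2 ∈ T
  · by_cases hp₁ : p.1 ∈ T
    · calc _ ≤ (v p.1 ^ 2 + v p.2 ^ 2) * ENNReal.ofReal (increment η p ^ 2) := by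
            gcongr
            exact mul_le_sq_add_sq _ _
        _ ≤ g p + g p.swap := by
            rw [add_mul]
            gcongr
            · exact hnear p hp₁
            · exact hswap p ▸ hnear p.swap hp₂
    · have h := hcross p.swap hp₁
      rw [hswap, Prod.fst_swap, Prod.snd_swap, mul_comm (v p.2)] at h
      exact h.trans le_add_self
  · exact (hcross p hp₂).trans le_self_add

theorem lintegral_mul_mul_increment_sq_le {v : EuclideanSpace ℝ (Fin N) → ℝ≥0∞} {A : ℝ≥0∞}
    (hs0 : 0 < s) (hR : ρ < R) (hv : Measurable v) (hηm : Measurable η)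
    (hη01 : ∀ x, η x ∈ Set.Icc 0 1) (hηρ : Function.support η ⊆ ball x₀ ρ)
    (hηA : ∀ x, fracGradSq s η x ≤ A) :
    ∫⁻ p, v p.1 * v p.2 * ENNReal.ofReal (increment η p ^ 2) ∂gagliardoMeasure N s
      ≤ 2 * (A * (∫⁻ x in ball x₀ R, v x ^ 2)
        + ENNReal.ofReal ((R / (R - ρ)) ^ ((N : ℝ) + 2 * s)) * (∫⁻ x in ball x₀ ρ, v x)
          * ∫⁻ y in (ball x₀ R)ᶜ, v y * ENNReal.ofReal (fracKernel s y x₀)) := by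
  have hBR : MeasurableSet (ball x₀ R) := measurableSet_ball
  have hmeas : MeasurableSet (ball x₀ ρ ×ˢ (ball x₀ R)ᶜ) :=
    measurableSet_ball.prod measurableSet_ball.compl
  set near : EuclideanSpace ℝ (Fin N) × EuclideanSpace ℝ (Fin N) → ℝ≥0∞ := fun p =>
    (ball x₀ R).indicator (fun x => v x ^ 2) p.1 * ENNReal.ofReal (increment η p ^ 2) with hnear
  set far : EuclideanSpace ℝ (Fin N) × EuclideanSpace ℝ (Fin N) → ℝ≥0∞ :=
    (ball x₀ ρ ×ˢ (ball x₀ R)ᶜ).indicator fun p => v p.1 * v p.2 with hfar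
  have hvm : Measurable ((ball x₀ R).indicator fun x => v x ^ 2) :=
    Measurable.indicator (by fun_prop) hBR
  have hnear_m : Measurable near := by fun_prop
  have hfar_m : Measurable far := Measurable.indicator (by fun_prop) hmeas
  have hle : ∀ p, v p.1 * v p.2 * ENNReal.ofReal (increment η p ^ 2)
      ≤ (near + far) p + (near + far) p.swap := by
    refine mul_mul_increment_sq_le (ball_subset_ball hR.le) hη01 hηρ (fun p hp => ?_)
      (fun p hp₁ hp₂ => ?_)
    · refine le_of_eq_of_le ?_ le_self_add
      simp only [hnear, Set.indicator_of_mem hp]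
    · refine le_of_eq_of_le ?_ le_add_self
      rw [hfar, Set.indicator_of_mem (show p ∈ ball x₀ ρ ×ˢ (ball x₀ R)ᶜ from ⟨hp₁, hp₂⟩)]
  have hnear_int : ∫⁻ p, near p ∂gagliardoMeasure N s ≤ A * ∫⁻ x in ball x₀ R, v x ^ 2 := by
    rw [hnear, lintegral_fst_mul_increment_sq hvm hηm, mul_comm,
      ← lintegral_indicator hBR, ← lintegral_mul_const _ hvm]
    gcongr with x
    exact hηA x
  calc _ ≤ ∫⁻ p, (near + far) p + (near + far) p.swap ∂gagliardoMeasure N s :=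
        lintegral_mono hle
    _ = 2 * ∫⁻ p, (near + far) p ∂gagliardoMeasure N s := by
        rw [lintegral_add_left (hnear_m.add hfar_m),
          measurePreserving_swap_gagliardoMeasure.lintegral_comp (hnear_m.add hfar_m), two_mul]
    _ ≤ _ := by
        simp only [Pi.add_apply]
        rw [lintegral_add_left hnear_m, hfar, lintegral_indicator hmeas]
        gcongr
        exact setLIntegral_ball_prod_compl_ball_gagliardoMeasure_le hs0 hR hv

theorem IsWeakSubsolution.gagliardoEnergy_mul_posPart_le [NeZero N]
    {U : Set (EuclideanSpace ℝ (Fin N))}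
    {w : EuclideanSpace ℝ (Fin N) → ℝ} {F k : ℝ} {A : ℝ≥0∞} (hs0 : 0 < s) (hs1 : s < 1)
    (hw : IsWeakSubsolution s U (fun _ => F) w) (hwm : Measurable w)
    (hη : IsTestFunction U η) (hη01 : ∀ x, η x ∈ Set.Icc 0 1)
    (hηρ : Function.support η ⊆ ball x₀ ρ) (hηA : ∀ x, fracGradSq s η x ≤ A) (hR : ρ < R)
    (hv : MemLp (fun x => (w x - k)⁺) 2 (volume.restrict (ball x₀ ρ))) :
    gagliardoEnergy s (fun x => η x * (w x - k)⁺)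
      ≤ ENNReal.ofReal F * (∫⁻ x in ball x₀ ρ, ENNReal.ofReal (w x - k)⁺)
        + 2 * (A * (∫⁻ x in ball x₀ R, ENNReal.ofReal ((w x - k)⁺ ^ 2))
          + ENNReal.ofReal ((R / (R - ρ)) ^ ((N : ℝ) + 2 * s))
            * (∫⁻ x in ball x₀ ρ, ENNReal.ofReal (w x - k)⁺)
            * ∫⁻ y in (ball x₀ R)ᶜ, ENNReal.ofReal ((w y - k)⁺ * fracKernel s y x₀)) := by
  have hηm := hη.measurable
  have hq : IsTestFunction U fun x => η x * η x := hη.mul_left hη.1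
  have hq01 : ∀ x, η x * η x ∈ Set.Icc 0 1 := fun x =>
    ⟨mul_self_nonneg _, mul_le_one₀ (hη01 x).2 (hη01 x).1 (hη01 x).2⟩
  have hqρ : (Function.support fun x => η x * η x) ⊆ ball x₀ ρ :=
    (Function.support_mul_subset_left η η).trans hηρ
  have hvq := hv.mono_measure (Measure.restrict_mono_set volume hqρ)
  have hv0 : ∀ x, 0 ≤ (w x - k)⁺ := fun x => posPart_nonneg _
  have hrhs : ENNReal.ofReal (∫ p, increment w p * increment (fun x => η x * η x * (w x - k)⁺) p
        ∂gagliardoMeasure N s)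
      ≤ ENNReal.ofReal F * ∫⁻ x in ball x₀ ρ, ENNReal.ofReal (w x - k)⁺ := by
    rw [← gagliardoForm_eq_integral]
    refine (ENNReal.ofReal_le_ofReal
      (hw.gagliardoForm_mul_posPart_le hs0 hs1 hwm hq hq01 hvq)).trans ?_
    rw [ENNReal.ofReal_mul' (integral_nonneg fun x => mul_nonneg (hq01 x).1 (hv0 x)),
      ofReal_integral_eq_lintegral_ofReal (hq.integrable_mul_of_memLp hvq)
        (Eventually.of_forall fun x => mul_nonneg (hq01 x).1 (hv0 x)),
      ← lintegral_indicator measurableSet_ball]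
    gcongr with x
    by_cases hx : x ∈ ball x₀ ρ
    · rw [Set.indicator_of_mem hx]
      exact ENNReal.ofReal_le_ofReal (mul_le_of_le_one_left (hv0 x) (hq01 x).2)
    · simp [Function.notMem_support.1 fun h => hx (hηρ h)]
  rw [gagliardoEnergy_eq_lintegral]
  refine (lintegral_ofReal_le_of_le_add
    (H := fun p => increment w p * increment (fun x => η x * η x * (w x - k)⁺) p)
    (R := fun p => (w p.1 - k)⁺ * (w p.2 - k)⁺ * increment η p ^ 2)
    (integrable_increment_mul_posPart hs0 hs1 (hw.1.memLp_increment hs0 hs1) hwm hq hq01 hvq)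
    (by fun_prop) (fun p => sq_nonneg _) (fun p => by positivity) fun p => ?_).trans
    (add_le_add hrhs ?_)
  · have := sq_mul_posPart_sub_le (w p.1 - k) (w p.2 - k) (η p.1) (η p.2)
    simp only [increment]
    linarith
  · simp only [ENNReal.ofReal_mul, hv0, mul_nonneg, ENNReal.ofReal_pow]
    exact lintegral_mul_mul_increment_sq_le hs0 hR (by fun_prop) hηm hη01 hηρ hηA

end Caccioppoli

section FaberKrahn

variable {N : ℕ} {s : ℝ} {u : EuclideanSpace ℝ (Fin N) → ℝ} {S : Set (EuclideanSpace ℝ (Fin N))}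

theorem gagliardoEnergy_eq_lintegral_fracGradSq (hu : Measurable u) :
    gagliardoEnergy s u = ∫⁻ x, fracGradSq s u x := by
  rw [gagliardoEnergy_eq_lintegral]
  simpa using lintegral_fst_mul_increment_sq (s := s) (measurable_const (a := (1 : ℝ≥0∞))) hu

theorem volume_ball_diff_mul_sq_le (hs0 : 0 < s) (hS : MeasurableSet S)
    (huS : Function.support u ⊆ S) {x : EuclideanSpace ℝ (Fin N)} (hx : x ∈ S) {ρ : ℝ}
    (hρ : 0 < ρ) :
    volume (ball x ρ \ S) * ENNReal.ofReal (u x ^ 2)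
      ≤ ENNReal.ofReal (ρ ^ ((N : ℝ) + 2 * s)) * fracGradSq s u x := by
  have hker : ∀ y ∈ ball x ρ \ S,
      u x ^ 2 ≤ ρ ^ ((N : ℝ) + 2 * s) * ((u x - u y) ^ 2 * fracKernel s x y) := by
    rintro y ⟨hyρ, hyS⟩
    have hxy : 0 < ‖x - y‖ := norm_pos_iff.2 (sub_ne_zero.2 fun h => hyS (h ▸ hx))
    have hxyρ : ‖x - y‖ ≤ ρ := by
      rw [← dist_eq_norm, dist_comm]
      exact (mem_ball.1 hyρ).le
    rw [Function.notMem_support.1 fun h => hyS (huS h), sub_zero, mul_left_comm]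
    refine le_mul_of_one_le_right (sq_nonneg _) ?_
    rw [fracKernel, ← div_eq_mul_inv, one_le_div (by positivity)]
    gcongr
  calc volume (ball x ρ \ S) * ENNReal.ofReal (u x ^ 2)
      = ∫⁻ _ in ball x ρ \ S, ENNReal.ofReal (u x ^ 2) := by rw [setLIntegral_const, mul_comm]
    _ ≤ ∫⁻ y in ball x ρ \ S, ENNReal.ofReal (ρ ^ ((N : ℝ) + 2 * s))
          * ENNReal.ofReal ((u x - u y) ^ 2 * fracKernel s x y) := by
        refine setLIntegral_mono' (measurableSet_ball.diff hS) fun y hy => ?_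
        rw [← ENNReal.ofReal_mul (by positivity)]
        exact ENNReal.ofReal_le_ofReal (hker y hy)
    _ ≤ _ := by
        rw [lintegral_const_mul' _ _ ENNReal.ofReal_ne_top]
        gcongr
        exact setLIntegral_le_lintegral _ _

/- On a ball of twice the volume of `S` around `x ∈ S`, the function `u` vanishes on a set at least
as large as `S`. -/
theorem exists_lintegral_sq_le_mul_gagliardoEnergy [NeZero N] (hs0 : 0 < s) :
    ∃ C : ℝ, 0 < C ∧ ∀ (u : EuclideanSpace ℝ (Fin N) → ℝ) (S : Set (EuclideanSpace ℝ (Fin N))),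
      Measurable u → MeasurableSet S → volume S ≠ ⊤ → Function.support u ⊆ S →
        ∫⁻ x, ENNReal.ofReal (u x ^ 2)
          ≤ ENNReal.ofReal C * volume S ^ (2 * s / N) * gagliardoEnergy s u := by
  have hN : (0 : ℝ) < N := Nat.cast_pos.2 (NeZero.pos N)
  set κ : ℝ := volume.real (ball (0 : EuclideanSpace ℝ (Fin N)) 1) with hκ
  have hκ0 : 0 < κ := ENNReal.toReal_pos (measure_ball_pos _ _ one_pos).ne' measure_ball_lt_top.ne
  refine ⟨(2 / κ) ^ (1 + 2 * s / N), by positivity, fun u S hu hS hStop huS => ?_⟩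
  obtain ⟨m, hm⟩ : ∃ m, volume S = ENNReal.ofReal m := ⟨_, (ENNReal.ofReal_toReal hStop).symm⟩
  obtain hm0 | hm0 := le_or_gt m 0
  · have hu0 : ∀ᵐ x, u x = 0 := by
      filter_upwards [measure_eq_zero_iff_ae_notMem.1
        (hm.trans (ENNReal.ofReal_of_nonpos hm0))] with x hx
      exact Function.notMem_support.1 fun h => hx (huS h)
    rw [lintegral_congr_ae (g := 0) (by filter_upwards [hu0] with x hx; simp [hx])]
    simp
  set ρ : ℝ := (2 * m / κ) ^ ((N : ℝ)⁻¹) with hρ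
  have hρ0 : 0 < ρ := by positivity
  have hρN : ρ ^ N * κ = 2 * m := by
    rw [hρ, Real.rpow_inv_natCast_pow (by positivity) (NeZero.ne N)]
    field_simp
  have hρP : ρ ^ ((N : ℝ) + 2 * s) = m * ((2 / κ) ^ (1 + 2 * s / N) * m ^ (2 * s / N)) := by
    rw [hρ, ← Real.rpow_mul (by positivity), inv_mul_eq_div, add_div, div_self hN.ne',
      mul_div_right_comm, Real.mul_rpow (by positivity) hm0.le, Real.rpow_add hm0, Real.rpow_one]
    ring
  have hball : ∀ x : EuclideanSpace ℝ (Fin N), volume S ≤ volume (ball x ρ \ S) := fun x => by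
    refine le_trans (le_of_eq ?_) (le_measure_sdiff (μ := volume))
    rw [Measure.addHaar_ball_of_pos _ _ hρ0, finrank_euclideanSpace_fin,
      ← ofReal_measureReal measure_ball_lt_top.ne, ← ENNReal.ofReal_mul (by positivity), ← hκ,
      hρN, hm, ← ENNReal.ofReal_sub _ hm0.le]
    ring_nf
  have hmain : volume S * ∫⁻ x, ENNReal.ofReal (u x ^ 2)
      ≤ ENNReal.ofReal (ρ ^ ((N : ℝ) + 2 * s)) * gagliardoEnergy s u := by
    rw [gagliardoEnergy_eq_lintegral_fracGradSq hu, ← lintegral_const_mul' _ _ hStop,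
      ← lintegral_const_mul' _ _ ENNReal.ofReal_ne_top]
    refine lintegral_mono fun x => ?_
    by_cases hx : x ∈ S
    · exact (mul_le_mul_left (hball x) _).trans (volume_ball_diff_mul_sq_le hs0 hS huS hx hρ0)
    · simp [Function.notMem_support.1 fun h => hx (huS h)]
  rw [hρP, ENNReal.ofReal_mul hm0.le, ← hm, mul_assoc] at hmain
  refine (ENNReal.mul_le_mul_iff_right ?_ hStop).1 (hmain.trans_eq ?_)
  · simpa [hm] using hm0
  · rw [ENNReal.ofReal_mul (by positivity), hm, ENNReal.ofReal_rpow_of_pos hm0]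

end FaberKrahn

section LevelSets

variable {α : Type*} [MeasurableSpace α] {μ : Measure α} {w : α → ℝ} {k k' : ℝ}

theorem posPart_sub_le_inv_mul_sq {a : ℝ} (hk : k < k') :
    (a - k')⁺ ≤ (k' - k)⁻¹ * (a - k)⁺ ^ 2 := by
  have hkk : 0 < k' - k := sub_pos.2 hk
  rw [inv_mul_eq_div, le_div_iff₀ hkk]
  obtain ha | ha := le_total a k'
  · rw [posPart_of_nonpos (sub_nonpos.2 ha), zero_mul]
    positivity
  · rw [posPart_of_nonneg (sub_nonneg.2 ha), posPart_of_nonneg (sub_nonneg.2 (hk.le.trans ha))]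
    nlinarith

theorem lintegral_posPart_sub_le_inv_mul (hk : k < k') :
    ∫⁻ x, ENNReal.ofReal (w x - k')⁺ ∂μ
      ≤ ENNReal.ofReal (k' - k)⁻¹ * ∫⁻ x, ENNReal.ofReal ((w x - k)⁺ ^ 2) ∂μ := by
  rw [← lintegral_const_mul' _ _ ENNReal.ofReal_ne_top]
  refine lintegral_mono fun x => ?_
  rw [← ENNReal.ofReal_mul (inv_nonneg.2 (sub_nonneg.2 hk.le))]
  exact ENNReal.ofReal_le_ofReal (posPart_sub_le_inv_mul_sq hk)

theorem lintegral_posPart_sub_sq_antitone (w : α → ℝ) (μ : Measure α) :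
    Antitone fun k => ∫⁻ x, ENNReal.ofReal ((w x - k)⁺ ^ 2) ∂μ := fun _ _ hk =>
  lintegral_mono fun _ => ENNReal.ofReal_le_ofReal
    (pow_le_pow_left₀ (posPart_nonneg _) (posPart_mono (sub_le_sub_left hk _)) 2)

theorem measure_superlevel_le (hw : Measurable w) (hk : k < k') :
    μ {x | k' < w x}
      ≤ ENNReal.ofReal ((k' - k) ^ 2)⁻¹ * ∫⁻ x, ENNReal.ofReal ((w x - k)⁺ ^ 2) ∂μ := by
  rw [← lintegral_const_mul' _ _ ENNReal.ofReal_ne_top,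
    ← lintegral_indicator_one (measurableSet_lt measurable_const hw)]
  refine lintegral_mono fun x => Set.indicator_apply_le' (fun hx => ?_) fun _ => zero_le
  have hx' : k' - k ≤ (w x - k)⁺ := (sub_le_sub_right (le_of_lt hx) k).trans (le_posPart _)
  rw [← ENNReal.ofReal_mul (by positivity), Pi.one_apply, ENNReal.one_le_ofReal, inv_mul_eq_div,
    one_le_div (by positivity)]
  gcongr

theorem ofReal_mul_inv_sq_mul_rpow_mul {h β C D : ℝ} {Y : ℝ≥0∞} (hh : 0 < h) (hβ : 0 ≤ β)
    (hC : 0 ≤ C) :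
    ENNReal.ofReal C * (ENNReal.ofReal (h ^ 2)⁻¹ * Y) ^ β * (ENNReal.ofReal D * Y)
      = ENNReal.ofReal (C * D * h ^ (-(2 * β))) * Y ^ β * Y := by
  rw [ENNReal.mul_rpow_of_nonneg _ _ hβ, ENNReal.ofReal_rpow_of_nonneg (by positivity) hβ,
    Real.rpow_neg hh.le, Real.rpow_mul hh.le, Real.rpow_two, Real.inv_rpow (sq_nonneg h),
    mul_right_comm C, ENNReal.ofReal_mul (by positivity), ENNReal.ofReal_mul hC]
  ring

end LevelSets

section DeGiorgi

variable {N : ℕ} {s : ℝ}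

theorem exists_cutoff_fracGradSq_le [NeZero N] (hs0 : 0 < s) (hs1 : s < 1) :
    ∃ C : ℝ, 0 < C ∧ ∀ (x₀ : EuclideanSpace ℝ (Fin N)) (ρ R : ℝ), 0 < ρ → ρ < R →
      ∃ η : EuclideanSpace ℝ (Fin N) → ℝ, IsTestFunction (ball x₀ R) η ∧
        (∀ x, η x ∈ Set.Icc 0 1) ∧ (∀ x ∈ ball x₀ ρ, η x = 1) ∧
        Function.support η ⊆ ball x₀ ((ρ + R) / 2) ∧
        ∀ x, fracGradSq s η x ≤ ENNReal.ofReal (C * (R - ρ) ^ (-(2 * s))) := by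
  obtain ⟨C, hC, hgrad⟩ := exists_fracGradSq_le (N := N) hs0 hs1
  obtain ⟨L, hL, hcut⟩ := exists_smooth_cutoff (E := EuclideanSpace ℝ (Fin N))
  refine ⟨C * (2 * L) ^ (2 * s), by positivity, fun x₀ ρ R hρ hR => ?_⟩
  have hd : 0 < R - ρ := sub_pos.2 hR
  obtain ⟨η, hη, hη01, hη1, hηs, hηL⟩ := hcut x₀ ρ ((ρ + R) / 2) hρ (by linarith)
  have hts : tsupport η ⊆ closedBall x₀ ((ρ + R) / 2) :=
    closure_minimal (hηs.trans ball_subset_closedBall) isClosed_closedBall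
  refine ⟨η, ⟨hη, (isCompact_closedBall _ _).of_isClosed_subset (isClosed_tsupport η) hts,
    hts.trans (closedBall_subset_ball (by linarith))⟩, hη01, hη1, hηs, fun x => ?_⟩
  refine (hgrad η (2 * L / (R - ρ)) 1 (by positivity) one_pos x fun y => le_min ?_ ?_).trans_eq ?_
  · refine (hηL x y).trans_eq ?_
    rw [show (ρ + R) / 2 - ρ = (R - ρ) / 2 by ring, div_div_eq_mul_div, mul_comm L]
  · exact (abs_sub_le_of_le_of_le (hη01 x).1 (hη01 x).2 (hη01 y).1 (hη01 y).2).trans_eq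
      (sub_zero 1)
  · rw [one_pow, one_mul, div_one, Real.div_rpow (by positivity) hd.le, Real.rpow_neg hd.le]
    ring_nf

theorem IsWeakSubsolution.gagliardoEnergy_mul_posPart_le_of_lt [NeZero N]
    {U : Set (EuclideanSpace ℝ (Fin N))} {w η : EuclideanSpace ℝ (Fin N) → ℝ}
    {x₀ : EuclideanSpace ℝ (Fin N)} {ρ R F T A k k' : ℝ} (hs0 : 0 < s) (hs1 : s < 1)
    (hw : IsWeakSubsolution s U (fun _ => F) w) (hwm : Measurable w)
    (hη : IsTestFunction U η) (hη01 : ∀ x, η x ∈ Set.Icc 0 1)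
    (hηρ : Function.support η ⊆ ball x₀ ρ) (hηA : ∀ x, fracGradSq s η x ≤ ENNReal.ofReal A)
    (hρ : 0 < ρ) (hR : ρ < R) (hF : 0 ≤ F) (hT : 0 ≤ T) (hA : 0 ≤ A) (hk : k < k')
    (htail : ∫⁻ y in (ball x₀ R)ᶜ, ENNReal.ofReal ((w y - k')⁺ * fracKernel s y x₀)
      ≤ ENNReal.ofReal T)
    (hY : ∫⁻ x in ball x₀ R, ENNReal.ofReal ((w x - k)⁺ ^ 2) ≠ ⊤) :
    gagliardoEnergy s (fun x => η x * (w x - k')⁺)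
      ≤ ENNReal.ofReal ((F + 2 * ((R / (R - ρ)) ^ ((N : ℝ) + 2 * s) * T)) / (k' - k) + 2 * A)
        * ∫⁻ x in ball x₀ R, ENNReal.ofReal ((w x - k)⁺ ^ 2) := by
  set Y := ∫⁻ x in ball x₀ R, ENNReal.ofReal ((w x - k)⁺ ^ 2)
  set c := (R / (R - ρ)) ^ ((N : ℝ) + 2 * s)
  have hc0 : 0 ≤ c := Real.rpow_nonneg (div_nonneg (hρ.trans hR).le (sub_nonneg.2 hR.le)) _
  have hsub : ball x₀ ρ ⊆ ball x₀ R := ball_subset_ball hR.le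
  have hY₂ : ∫⁻ x in ball x₀ R, ENNReal.ofReal ((w x - k')⁺ ^ 2) ≤ Y :=
    lintegral_posPart_sub_sq_antitone w _ hk.le
  have hY₁ : ∫⁻ x in ball x₀ ρ, ENNReal.ofReal (w x - k')⁺ ≤ ENNReal.ofReal (k' - k)⁻¹ * Y :=
    (lintegral_mono_set hsub).trans (lintegral_posPart_sub_le_inv_mul hk)
  have hv : MemLp (fun x => (w x - k')⁺) 2 (volume.restrict (ball x₀ ρ)) := by
    rw [memLp_two_iff_lintegral_sq_ne_top (by fun_prop)]
    exact ne_top_of_le_ne_top hY ((lintegral_mono_set hsub).trans hY₂)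
  calc _ ≤ ENNReal.ofReal F * (ENNReal.ofReal (k' - k)⁻¹ * Y) + 2 * (ENNReal.ofReal A * Y
          + ENNReal.ofReal c * (ENNReal.ofReal (k' - k)⁻¹ * Y) * ENNReal.ofReal T) :=
        (hw.gagliardoEnergy_mul_posPart_le hs0 hs1 hwm hη hη01 hηρ hηA hR hv).trans (by gcongr)
    _ = (ENNReal.ofReal ((F + 2 * (c * T)) * (k' - k)⁻¹) + ENNReal.ofReal (2 * A)) * Y := by
        rw [ENNReal.ofReal_mul (by positivity), ENNReal.ofReal_add hF (by positivity),
          ENNReal.ofReal_mul zero_le_two, ENNReal.ofReal_mul zero_le_two, ENNReal.ofReal_mul hc0,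
          ENNReal.ofReal_ofNat]
        ring
    _ = _ := by rw [← ENNReal.ofReal_add (by positivity) (by positivity), div_eq_mul_inv]

theorem exists_cutoff_gagliardoEnergy_mul_posPart_le [NeZero N] (hs0 : 0 < s) (hs1 : s < 1) :
    ∃ C : ℝ, 0 < C ∧ ∀ (U : Set (EuclideanSpace ℝ (Fin N))) (w : EuclideanSpace ℝ (Fin N) → ℝ)
      (x₀ : EuclideanSpace ℝ (Fin N)) (ρ R F T k k' : ℝ), IsWeakSubsolution s U (fun _ => F) w →
      Measurable w → 0 < ρ → ρ < R → ball x₀ R ⊆ U → 0 ≤ F → 0 ≤ T → k < k' →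
      ∫⁻ y in (ball x₀ R)ᶜ, ENNReal.ofReal ((w y - k')⁺ * fracKernel s y x₀) ≤ ENNReal.ofReal T →
      ∫⁻ x in ball x₀ R, ENNReal.ofReal ((w x - k)⁺ ^ 2) ≠ ⊤ →
      ∃ η : EuclideanSpace ℝ (Fin N) → ℝ, Measurable η ∧ (∀ x ∈ ball x₀ ρ, η x = 1) ∧
        Function.support η ⊆ ball x₀ R ∧
        gagliardoEnergy s (fun x => η x * (w x - k')⁺)
          ≤ ENNReal.ofReal (C * ((F + (2 * R / (R - ρ)) ^ ((N : ℝ) + 2 * s) * T) / (k' - k)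
              + (R - ρ) ^ (-(2 * s)))) * ∫⁻ x in ball x₀ R, ENNReal.ofReal ((w x - k)⁺ ^ 2) := by
  obtain ⟨C, hC, hcut⟩ := exists_cutoff_fracGradSq_le (N := N) hs0 hs1
  refine ⟨2 + 2 * C, by positivity, fun U w x₀ ρ R F T k k' hw hwm hρ hR hU hF hT hk htail hY => ?_⟩
  obtain ⟨η, hη, hη01, hη1, hηs, hηC⟩ := hcut x₀ ρ R hρ hR
  have hR0 : 0 < R := hρ.trans hR
  refine ⟨η, hη.measurable, hη1, hηs.trans (ball_subset_ball (by linarith)), ?_⟩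
  refine (hw.gagliardoEnergy_mul_posPart_le_of_lt hs0 hs1 hwm ⟨hη.1, hη.2.1, hη.2.2.trans hU⟩
    hη01 hηs hηC (by linarith) (by linarith) hF hT (by positivity) hk htail hY).trans ?_
  gcongr ENNReal.ofReal ?_ * _
  rw [show R - (ρ + R) / 2 = (R - ρ) / 2 by ring, div_div_eq_mul_div, mul_comm R 2]
  have hFk : 0 ≤ F / (k' - k) := by positivity
  have hTk : 0 ≤ (2 * R / (R - ρ)) ^ ((N : ℝ) + 2 * s) * T / (k' - k) := by positivity
  have hda : 0 ≤ (R - ρ) ^ (-(2 * s)) := by positivity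
  rw [add_div, add_div, mul_div_assoc]
  nlinarith [mul_nonneg hC.le hFk, mul_nonneg hC.le hTk]

theorem exists_lintegral_posPart_sq_le [NeZero N] (hs0 : 0 < s) (hs1 : s < 1) :
    ∃ C : ℝ, 0 < C ∧ ∀ (U : Set (EuclideanSpace ℝ (Fin N))) (w : EuclideanSpace ℝ (Fin N) → ℝ)
      (x₀ : EuclideanSpace ℝ (Fin N)) (ρ R F T k k' : ℝ), IsWeakSubsolution s U (fun _ => F) w →
      Measurable w → 0 < ρ → ρ < R → ball x₀ R ⊆ U → 0 ≤ F → 0 ≤ T → k < k' →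
      ∫⁻ y in (ball x₀ R)ᶜ, ENNReal.ofReal ((w y - k')⁺ * fracKernel s y x₀) ≤ ENNReal.ofReal T →
      ∫⁻ x in ball x₀ R, ENNReal.ofReal ((w x - k)⁺ ^ 2) ≠ ⊤ →
      ∫⁻ x in ball x₀ ρ, ENNReal.ofReal ((w x - k')⁺ ^ 2)
        ≤ ENNReal.ofReal (C * ((F + (2 * R / (R - ρ)) ^ ((N : ℝ) + 2 * s) * T) / (k' - k)
            + (R - ρ) ^ (-(2 * s))) * (k' - k) ^ (-(2 * (2 * s / N))))
          * (∫⁻ x in ball x₀ R, ENNReal.ofReal ((w x - k)⁺ ^ 2)) ^ (2 * s / N)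
          * ∫⁻ x in ball x₀ R, ENNReal.ofReal ((w x - k)⁺ ^ 2) := by
  obtain ⟨C₁, hC₁, hcut⟩ := exists_cutoff_gagliardoEnergy_mul_posPart_le (N := N) hs0 hs1
  obtain ⟨C₂, hC₂, hFK⟩ := exists_lintegral_sq_le_mul_gagliardoEnergy (N := N) hs0
  refine ⟨C₂ * C₁, by positivity,
    fun U w x₀ ρ R F T k k' hw hwm hρ hR hU hF hT hk htail hY => ?_⟩
  obtain ⟨η, hη, hη1, hηs, henergy⟩ :=
    hcut U w x₀ ρ R F T k k' hw hwm hρ hR hU hF hT hk htail hY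
  set Y := ∫⁻ x in ball x₀ R, ENNReal.ofReal ((w x - k)⁺ ^ 2)
  set S : Set (EuclideanSpace ℝ (Fin N)) := {x | k' < w x} ∩ ball x₀ R with hS
  have hLm : MeasurableSet {x | k' < w x} := measurableSet_lt measurable_const hwm
  have hSY : volume S ≤ ENNReal.ofReal ((k' - k) ^ 2)⁻¹ * Y := by
    rw [hS, ← Measure.restrict_apply hLm]
    exact measure_superlevel_le hwm hk
  have hsupp : (Function.support fun x => η x * (w x - k')⁺) ⊆ S := fun x hx => by
    rw [Function.mem_support, mul_ne_zero_iff] at hx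
    exact ⟨by simpa using hx.2, hηs hx.1⟩
  calc ∫⁻ x in ball x₀ ρ, ENNReal.ofReal ((w x - k')⁺ ^ 2)
      ≤ ∫⁻ x, ENNReal.ofReal ((η x * (w x - k')⁺) ^ 2) := by
        refine (setLIntegral_mono' measurableSet_ball fun x hx => ?_).trans
          (setLIntegral_le_lintegral (ball x₀ ρ) fun x => ENNReal.ofReal ((η x * (w x - k')⁺) ^ 2))
        rw [hη1 x hx, one_mul]
    _ ≤ ENNReal.ofReal C₂ * volume S ^ (2 * s / N)
          * gagliardoEnergy s fun x => η x * (w x - k')⁺ :=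
        hFK _ S (by fun_prop) (hLm.inter measurableSet_ball)
          (measure_inter_lt_top_of_right_ne_top measure_ball_lt_top.ne).ne hsupp
    _ ≤ ENNReal.ofReal C₂ * (ENNReal.ofReal ((k' - k) ^ 2)⁻¹ * Y) ^ (2 * s / N) * (_ * Y) := by
        gcongr
    _ = _ := by
        rw [ofReal_mul_inv_sq_mul_rpow_mul (sub_pos.2 hk) (by positivity) hC₂.le, ← mul_assoc C₂]

end DeGiorgi

section Iteration

variable {N : ℕ} {s : ℝ}

/-- The truncated `L²` masses of De Giorgi's iteration, with levels increasing from `0` to `l` while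
the radii decrease from `r` to `r / 2`. -/
noncomputable def deGiorgiMass (w : EuclideanSpace ℝ (Fin N) → ℝ) (x₀ : EuclideanSpace ℝ (Fin N))
    (r l : ℝ) (n : ℕ) : ℝ≥0∞ :=
  ∫⁻ x in ball x₀ (r / 2 * (1 + (2 ^ n)⁻¹)), ENNReal.ofReal ((w x - l * (1 - (2 ^ n)⁻¹))⁺ ^ 2)

theorem deGiorgiMass_zero (w : EuclideanSpace ℝ (Fin N) → ℝ) (x₀ : EuclideanSpace ℝ (Fin N))
    (r l : ℝ) : deGiorgiMass w x₀ r l 0 = ∫⁻ x in ball x₀ r, ENNReal.ofReal ((w x)⁺ ^ 2) := by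
  simp only [deGiorgiMass, pow_zero, inv_one, sub_self, mul_zero, sub_zero, one_add_one_eq_two,
    div_mul_cancel₀ r two_ne_zero]

theorem lintegral_ball_posPart_sub_sq_mono (w : EuclideanSpace ℝ (Fin N) → ℝ)
    (x₀ : EuclideanSpace ℝ (Fin N)) {ρ R k k' : ℝ} (hρ : ρ ≤ R) (hk : k ≤ k') :
    ∫⁻ x in ball x₀ ρ, ENNReal.ofReal ((w x - k')⁺ ^ 2)
      ≤ ∫⁻ x in ball x₀ R, ENNReal.ofReal ((w x - k)⁺ ^ 2) :=
  (lintegral_mono_set (ball_subset_ball hρ)).trans (lintegral_posPart_sub_sq_antitone w _ hk)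

theorem deGiorgiMass_le_zero (w : EuclideanSpace ℝ (Fin N) → ℝ) (x₀ : EuclideanSpace ℝ (Fin N))
    {r l : ℝ} (hr : 0 ≤ r) (hl : 0 ≤ l) (n : ℕ) :
    deGiorgiMass w x₀ r l n ≤ deGiorgiMass w x₀ r l 0 := by
  have ht : ((2 : ℝ) ^ n)⁻¹ ≤ (2 ^ 0)⁻¹ := by gcongr <;> simp
  exact lintegral_ball_posPart_sub_sq_mono w x₀ (by gcongr) (by gcongr)

theorem ae_le_of_deGiorgiMass_le_pow_mul {w : EuclideanSpace ℝ (Fin N) → ℝ} (hw : Measurable w)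
    {x₀ : EuclideanSpace ℝ (Fin N)} {r l : ℝ} (hr : 0 ≤ r) (hl : 0 ≤ l) {q : ℝ≥0∞} (hq : q < 1)
    (h₀ : deGiorgiMass w x₀ r l 0 ≠ ⊤)
    (h : ∀ n, deGiorgiMass w x₀ r l n ≤ q ^ n * deGiorgiMass w x₀ r l 0) :
    ∀ᵐ x ∂volume.restrict (ball x₀ (r / 2)), w x ≤ l := by
  have hlim : Tendsto (fun n => q ^ n * deGiorgiMass w x₀ r l 0) atTop (𝓝 0) := by
    simpa only [zero_mul] using
      ENNReal.Tendsto.mul_const (ENNReal.tendsto_pow_atTop_nhds_zero_of_lt_one hq) (Or.inr h₀)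
  have hzero : ∫⁻ x in ball x₀ (r / 2), ENNReal.ofReal ((w x - l)⁺ ^ 2) = 0 := by
    refine le_antisymm (ge_of_tendsto' hlim fun n => le_trans ?_ (h n)) zero_le
    have ht : (0 : ℝ) ≤ (2 ^ n)⁻¹ := by positivity
    exact lintegral_ball_posPart_sub_sq_mono w x₀ (by nlinarith) (by nlinarith)
  filter_upwards [(lintegral_eq_zero_iff (by fun_prop)).1 hzero] with x hx
  have hsq : (w x - l)⁺ ^ 2 = 0 := (ENNReal.ofReal_eq_zero.1 hx).antisymm (sq_nonneg _)
  exact sub_nonpos.1 (posPart_eq_zero.1 (sq_eq_zero_iff.1 hsq))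

theorem deGiorgi_coeff_le {F D P σ r l t : ℝ} (hσ : 0 ≤ σ) (hσP : σ ≤ P) (hr : 0 < r) (hl : 0 < l)
    (ht : 1 ≤ t) (hD : r ^ (-σ) ≤ D) (hF : F ≤ l * D) :
    (F + (8 * t) ^ P * (4 * (l * D))) / (l / (2 * t)) + (r / (4 * t)) ^ (-σ)
      ≤ 11 * D * (t * (8 * t) ^ P) := by
  have hD0 : 0 ≤ D := (Real.rpow_nonneg hr.le _).trans hD
  have htP : 1 ≤ (8 * t) ^ P := Real.one_le_rpow (by linarith) (hσ.trans hσP)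
  have hsource :
      (F + (8 * t) ^ P * (4 * (l * D))) / (l / (2 * t)) ≤ 10 * D * (t * (8 * t) ^ P) := by
    rw [div_le_iff₀ (by positivity)]
    calc F + (8 * t) ^ P * (4 * (l * D)) ≤ (8 * t) ^ P * (l * D) + (8 * t) ^ P * (4 * (l * D)) := by
          gcongr
          exact hF.trans (le_mul_of_one_le_left (by positivity) htP)
      _ = 10 * D * (t * (8 * t) ^ P) * (l / (2 * t)) := by field_simp; ring
  have hcutoff : (r / (4 * t)) ^ (-σ) ≤ D * (t * (8 * t) ^ P) := by
    rw [Real.div_rpow hr.le (by positivity), div_eq_mul_inv, ← Real.rpow_neg (by positivity),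
      neg_neg]
    gcongr
    calc (4 * t) ^ σ ≤ (8 * t) ^ σ := by gcongr; norm_num
      _ ≤ (8 * t) ^ P := Real.rpow_le_rpow_of_exponent_le (by linarith) hσP
      _ ≤ t * (8 * t) ^ P := le_mul_of_one_le_left (by positivity) ht
  linarith

theorem mul_rpow_mul_div_rpow_eq {P β l t : ℝ} (hl : 0 < l) (ht : 0 < t) :
    t * (8 * t) ^ P * (l / (2 * t)) ^ (-(2 * β))
      = 8 ^ P * 4 ^ β * l ^ (-(2 * β)) * t ^ (1 + P + 2 * β) := by
  rw [Real.div_rpow hl.le (by positivity), Real.mul_rpow (by norm_num) ht.le, div_eq_mul_inv,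
    ← Real.rpow_neg (by positivity), neg_neg, Real.mul_rpow zero_le_two ht.le,
    Real.rpow_mul zero_le_two, Real.rpow_two, Real.rpow_add ht, Real.rpow_add ht, Real.rpow_one]
  norm_num
  ring

theorem deGiorgi_coeff_mul_rpow_le {F D P σ β r l t a : ℝ} (hσ : 0 ≤ σ) (hσP : σ ≤ P)
    (hr : 0 < r) (hl : 0 < l) (ht : 1 ≤ t) (hD : r ^ (-σ) ≤ D) (hF : F ≤ l * D) (ha : 0 ≤ a)
    (hat : a ≤ 8 * t) :
    ((F + a ^ P * (4 * (l * D))) / (l / (2 * t)) + (r / (4 * t)) ^ (-σ))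
        * (l / (2 * t)) ^ (-(2 * β))
      ≤ 11 * (8 ^ P * 4 ^ β) * (D * l ^ (-(2 * β)) * t ^ (1 + P + 2 * β)) := by
  have ht0 : 0 < t := one_pos.trans_le ht
  have hD0 : 0 ≤ D := (Real.rpow_nonneg hr.le _).trans hD
  have hP : 0 ≤ P := hσ.trans hσP
  calc _ ≤ 11 * D * (t * (8 * t) ^ P) * (l / (2 * t)) ^ (-(2 * β)) := by
        gcongr
        refine le_trans ?_ (deGiorgi_coeff_le hσ hσP hr hl ht hD hF)
        gcongr
    _ = 11 * D * (t * (8 * t) ^ P * (l / (2 * t)) ^ (-(2 * β))) := by ring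
    _ = _ := by rw [mul_rpow_mul_div_rpow_eq hl ht0]; ring

theorem exists_deGiorgiMass_succ_le [NeZero N] (hs0 : 0 < s) (hs1 : s < 1) :
    ∃ C : ℝ, 0 < C ∧ ∀ (U : Set (EuclideanSpace ℝ (Fin N))) (w : EuclideanSpace ℝ (Fin N) → ℝ)
      (x₀ : EuclideanSpace ℝ (Fin N)) (r F l D : ℝ), IsWeakSubsolution s U (fun _ => F) w →
      Measurable w → 0 < r → ball x₀ r ⊆ U → 0 ≤ F → 0 < l →
      r ^ (-(2 * s)) ≤ D → F ≤ l * D →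
      ∫⁻ y in (ball x₀ (r / 2))ᶜ, ENNReal.ofReal ((w y)⁺ * fracKernel s y x₀)
        ≤ ENNReal.ofReal (4 * (l * D)) →
      deGiorgiMass w x₀ r l 0 ≠ ⊤ → ∀ n, deGiorgiMass w x₀ r l (n + 1)
        ≤ ENNReal.ofReal (C * D * l ^ (-(2 * (2 * s / N))))
          * ENNReal.ofReal (2 ^ (1 + (N + 2 * s) + 2 * (2 * s / N))) ^ n
          * deGiorgiMass w x₀ r l n ^ (2 * s / N) * deGiorgiMass w x₀ r l n := by
  obtain ⟨C, hC, hstep⟩ := exists_lintegral_posPart_sq_le (N := N) hs0 hs1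
  refine ⟨C * 11 * (8 ^ (N + 2 * s) * 4 ^ (2 * s / N)), by positivity,
    fun U w x₀ r F l D hw hwm hr hU hF hl hD hFD htail h₀ n => ?_⟩
  obtain ⟨t, ht, ht1⟩ : ∃ t : ℝ, t = 2 ^ n ∧ 1 ≤ t := ⟨_, rfl, one_le_pow₀ one_le_two⟩
  have ht0 : 0 < t := one_pos.trans_le ht1
  have htinv : t⁻¹ ≤ 1 := inv_le_one_of_one_le₀ ht1
  have hradii : r / 2 * (1 + t⁻¹) - r / 2 * (1 + (t * 2)⁻¹) = r / (4 * t) := by field_simp; ring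
  have hlevels : l * (1 - (t * 2)⁻¹) - l * (1 - t⁻¹) = l / (2 * t) := by field_simp; ring
  have hlevel : 0 ≤ l * (1 - (t * 2)⁻¹) :=
    mul_nonneg hl.le (sub_nonneg.2 (inv_le_one_of_one_le₀ (by linarith)))
  have hratio : 2 * (r / 2 * (1 + t⁻¹)) / (r / (4 * t)) ≤ 8 * t := by
    rw [div_le_iff₀ (by positivity)]
    field_simp
    linarith
  have hD0 : 0 ≤ D := (Real.rpow_nonneg hr.le _).trans hD
  have hmain := hstep U w x₀ (r / 2 * (1 + (t * 2)⁻¹)) (r / 2 * (1 + t⁻¹)) F (4 * (l * D))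
    (l * (1 - t⁻¹)) (l * (1 - (t * 2)⁻¹)) hw hwm (by positivity)
    (sub_pos.1 (hradii ▸ by positivity)) ((ball_subset_ball (by nlinarith)).trans hU) hF
    (by positivity) (sub_pos.1 (hlevels ▸ by positivity)) ?_
    (ht ▸ ne_top_of_le_ne_top h₀ (deGiorgiMass_le_zero w x₀ hr.le hl.le n))
  · rw [hradii, hlevels] at hmain
    simp only [deGiorgiMass, pow_succ, ← ht]
    refine hmain.trans ?_
    rw [← ENNReal.ofReal_pow (by positivity), ← ENNReal.ofReal_mul (by positivity)]
    gcongr ENNReal.ofReal ?_ * _ * _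
    rw [Real.rpow_pow_comm zero_le_two, ← ht, mul_assoc C]
    refine (mul_le_mul_of_nonneg_left (deGiorgi_coeff_mul_rpow_le (by positivity)
      (le_add_of_nonneg_left N.cast_nonneg) hr hl ht1 hD hFD (by positivity) hratio)
      hC.le).trans_eq (by ring)
  · refine le_trans ((lintegral_mono_set ?_).trans (lintegral_mono fun y => ?_)) htail
    · exact Set.compl_subset_compl.2 (ball_subset_ball (by nlinarith [inv_pos.2 ht0]))
    · gcongr
      · exact fracKernel_nonneg _ _
      · exact posPart_mono (sub_le_self _ hlevel)

theorem exists_ae_le_of_deGiorgiMass_zero_le [NeZero N] (hs0 : 0 < s) (hs1 : s < 1) :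
    ∃ θ : ℝ, 0 < θ ∧ ∀ (U : Set (EuclideanSpace ℝ (Fin N))) (w : EuclideanSpace ℝ (Fin N) → ℝ)
      (x₀ : EuclideanSpace ℝ (Fin N)) (r F l D : ℝ), IsWeakSubsolution s U (fun _ => F) w →
      Measurable w → 0 < r → ball x₀ r ⊆ U → 0 ≤ F → 0 < l → r ^ (-(2 * s)) ≤ D → F ≤ l * D →
      ∫⁻ y in (ball x₀ (r / 2))ᶜ, ENNReal.ofReal ((w y)⁺ * fracKernel s y x₀)
        ≤ ENNReal.ofReal (4 * (l * D)) →
      deGiorgiMass w x₀ r l 0 ≤ ENNReal.ofReal (θ * l ^ 2 * D ^ (-(N / (2 * s)))) →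
      ∀ᵐ x ∂volume.restrict (ball x₀ (r / 2)), w x ≤ l := by
  obtain ⟨C, hC, hstep⟩ := exists_deGiorgiMass_succ_le (N := N) hs0 hs1
  have hN : (0 : ℝ) < N := by exact_mod_cast NeZero.pos N
  set β : ℝ := 2 * s / N
  have hβ0 : 0 < β := by positivity
  set e : ℝ := 1 + (N + 2 * s) + 2 * β
  set q : ℝ := 2 ^ (-(e / β)) with hq
  have hq1 : q < 1 := Real.rpow_lt_one_of_one_lt_of_neg one_lt_two (neg_lt_zero.2 (by positivity))
  have hBq : 2 ^ e * q ^ β = 1 := by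
    rw [hq, ← Real.rpow_mul zero_le_two, neg_mul, div_mul_cancel₀ _ hβ0.ne',
      ← Real.rpow_add two_pos, add_neg_cancel, Real.rpow_zero]
  refine ⟨(q / C) ^ β⁻¹, by positivity,
    fun U w x₀ r F l D hw hwm hr hU hF hl hD hFD htail hY => ?_⟩
  have hD0 : 0 < D := (Real.rpow_pos_of_pos hr _).trans_le hD
  have h₀ : deGiorgiMass w x₀ r l 0 ≠ ⊤ := ne_top_of_le_ne_top ENNReal.ofReal_ne_top hY
  have hθ : C * D * l ^ (-(2 * β)) * ((q / C) ^ β⁻¹ * l ^ 2 * D ^ (-(N / (2 * s)))) ^ β = q := by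
    rw [show N / (2 * s) = β⁻¹ from (inv_div _ _).symm,
      Real.mul_rpow (by positivity) (by positivity), Real.mul_rpow (by positivity) (by positivity),
      ← Real.rpow_mul (by positivity), ← Real.rpow_mul hD0.le, neg_mul,
      inv_mul_cancel₀ hβ0.ne', Real.rpow_one, Real.rpow_neg_one,
      ← Real.rpow_natCast, ← Real.rpow_mul hl.le, Nat.cast_ofNat, Real.rpow_neg hl.le]
    field_simp
  refine ae_le_of_deGiorgiMass_le_pow_mul hwm hr.le hl.le (ENNReal.ofReal_lt_one.2 hq1) h₀
    (le_pow_mul_of_superlinear_recursion hβ0.le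
      (hstep U w x₀ r F l D hw hwm hr hU hF hl hD hFD htail h₀) ?_ ?_)
  · refine (mul_le_mul_right (ENNReal.rpow_le_rpow hY hβ0.le) _).trans_eq ?_
    rw [ENNReal.ofReal_rpow_of_nonneg (by positivity) hβ0.le, ← ENNReal.ofReal_mul (by positivity),
      hθ]
  · rw [ENNReal.ofReal_rpow_of_nonneg (by positivity) hβ0.le, ← ENNReal.ofReal_mul (by positivity),
      hBq, ENNReal.ofReal_one]

end Iteration

section LocalBoundedness

variable {N : ℕ} {s : ℝ}

theorem lintegral_compl_ball_le_of_nonlocalTail_le (hs1 : s ≤ 1)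
    {v : EuclideanSpace ℝ (Fin N) → ℝ} {x₀ : EuclideanSpace ℝ (Fin N)} {δ r l : ℝ} (hδ : 0 < δ)
    (hr : 0 < r) (hl : 0 ≤ l)
    (h : ENNReal.ofReal δ * nonlocalTail s v x₀ (r / 2) ≤ ENNReal.ofReal l) :
    ∫⁻ x in (ball x₀ (r / 2))ᶜ, ENNReal.ofReal (|v x| * fracKernel s x x₀)
      ≤ ENNReal.ofReal (4 * (l * (r ^ (-(2 * s)) / δ))) := by
  have hp : 0 < δ * (r / 2) ^ (2 * s) := by positivity
  have hle : (δ * (r / 2) ^ (2 * s))⁻¹ * l ≤ 4 * (l * (r ^ (-(2 * s)) / δ)) := by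
    have h4 : (2 : ℝ) ^ (2 * s) ≤ 4 :=
      (Real.rpow_le_rpow_of_exponent_le one_le_two (by linarith)).trans_eq
        (by norm_num : (2 : ℝ) ^ (2 : ℝ) = 4)
    calc (δ * (r / 2) ^ (2 * s))⁻¹ * l = 2 ^ (2 * s) * (l * (r ^ (-(2 * s)) / δ)) := by
          rw [Real.div_rpow hr.le zero_le_two, Real.rpow_neg hr.le]
          field_simp
      _ ≤ _ := by gcongr
  calc _ = ENNReal.ofReal (δ * (r / 2) ^ (2 * s))⁻¹
          * (ENNReal.ofReal δ * nonlocalTail s v x₀ (r / 2)) := by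
        rw [nonlocalTail, ← mul_assoc, ← mul_assoc, ← ENNReal.ofReal_mul (by positivity),
          ← ENNReal.ofReal_mul (by positivity), mul_assoc _ δ, inv_mul_cancel₀ hp.ne',
          ENNReal.ofReal_one, one_mul]
    _ ≤ ENNReal.ofReal (δ * (r / 2) ^ (2 * s))⁻¹ * ENNReal.ofReal l := by gcongr
    _ ≤ _ := by
        rw [← ENNReal.ofReal_mul (by positivity)]
        exact ENNReal.ofReal_le_ofReal hle

theorem nonlocalTail_mono {v w : EuclideanSpace ℝ (Fin N) → ℝ} (h : ∀ᵐ x, |v x| ≤ |w x|)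
    (x₀ : EuclideanSpace ℝ (Fin N)) (ρ : ℝ) : nonlocalTail s v x₀ ρ ≤ nonlocalTail s w x₀ ρ := by
  refine mul_le_mul_right (lintegral_mono_ae ?_) _
  filter_upwards [ae_restrict_of_ae h] with x hx
  gcongr
  exact fracKernel_nonneg _ _

theorem le_ofReal_of_ofReal_mul_rpow_half_le {a : ℝ≥0∞} {c l : ℝ} (hc : 0 < c) (hl : 0 ≤ l)
    (h : ENNReal.ofReal c * a ^ (1 / 2 : ℝ) ≤ ENNReal.ofReal l) :
    a ≤ ENNReal.ofReal ((l / c) ^ 2) := by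
  rw [mul_comm, ← ENNReal.le_div_iff_mul_le (Or.inl (ENNReal.ofReal_pos.2 hc).ne')
    (Or.inl ENNReal.ofReal_ne_top), ← ENNReal.ofReal_div_of_pos hc] at h
  calc a = (a ^ (1 / 2 : ℝ)) ^ 2 := by
        rw [← ENNReal.rpow_natCast, ← ENNReal.rpow_mul]
        norm_num
    _ ≤ ENNReal.ofReal (l / c) ^ 2 := by gcongr
    _ = _ := (ENNReal.ofReal_pow (by positivity) 2).symm

theorem exists_ae_le_of_nonlocalTail_le [NeZero N] (hs0 : 0 < s) (hs1 : s < 1) :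
    ∃ θ : ℝ, 0 < θ ∧ ∀ (U : Set (EuclideanSpace ℝ (Fin N))) (w : EuclideanSpace ℝ (Fin N) → ℝ)
      (x₀ : EuclideanSpace ℝ (Fin N)) (δ r F l : ℝ), IsWeakSubsolution s U (fun _ => F) w →
      Measurable w → 0 < δ → δ ≤ 1 → 0 < r → ball x₀ r ⊆ U → 0 ≤ F → 0 < l →
      ENNReal.ofReal δ * nonlocalTail s (fun x => (w x)⁺) x₀ (r / 2) ≤ ENNReal.ofReal l →
      δ * r ^ (2 * s) * F ≤ l →
      ⨍⁻ x in ball x₀ r, ENNReal.ofReal ((w x)⁺ ^ 2) ∂volume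
        ≤ ENNReal.ofReal (θ * δ ^ (N / (2 * s)) * l ^ 2) →
      ∀ᵐ x ∂volume.restrict (ball x₀ (r / 2)), w x ≤ l := by
  obtain ⟨θ, hθ, H⟩ := exists_ae_le_of_deGiorgiMass_zero_le (N := N) hs0 hs1
  set κ : ℝ := volume.real (ball (0 : EuclideanSpace ℝ (Fin N)) 1)
  have hκ : 0 < κ := ENNReal.toReal_pos (measure_ball_pos _ _ one_pos).ne' measure_ball_lt_top.ne
  refine ⟨θ / κ, by positivity, fun U w x₀ δ r F l hw hwm hδ hδ1 hr hU hF hl hT hFl hY => ?_⟩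
  refine H U w x₀ r F l (r ^ (-(2 * s)) / δ) hw hwm hr hU hF hl
    (le_div_self (by positivity) hδ hδ1) ?_ ?_ ?_
  · rw [Real.rpow_neg hr.le]
    field_simp
    linarith
  · simpa only [abs_of_nonneg (posPart_nonneg _)] using
      lintegral_compl_ball_le_of_nonlocalTail_le hs1.le hδ hr hl.le hT
  · have hvol : volume (ball x₀ r) = ENNReal.ofReal (r ^ N * κ) := by
      rw [Measure.addHaar_ball_of_pos _ _ hr, finrank_euclideanSpace_fin,
        ENNReal.ofReal_mul (by positivity), ofReal_measureReal measure_ball_lt_top.ne]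
    have hpow : (r ^ (-(2 * s)) / δ) ^ (-(N / (2 * s))) = r ^ N * δ ^ (N / (2 * s)) := by
      rw [Real.div_rpow (by positivity) hδ.le, ← Real.rpow_mul hr.le, Real.rpow_neg hδ.le,
        div_inv_eq_mul, neg_mul_neg, mul_div_cancel₀ _ (by positivity), Real.rpow_natCast]
    rw [deGiorgiMass_zero, ← measure_mul_setLAverage _ measure_ball_lt_top.ne, hvol]
    refine (mul_le_mul_right hY _).trans_eq ?_
    rw [← ENNReal.ofReal_mul (by positivity), hpow]
    congr 1
    field_simp

theorem exists_essSup_le_of_measurable [NeZero N] (hs0 : 0 < s) (hs1 : s < 1) :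
    ∃ C : ℝ, 0 < C ∧ ∀ (U : Set (EuclideanSpace ℝ (Fin N))) (w : EuclideanSpace ℝ (Fin N) → ℝ)
      (x₀ : EuclideanSpace ℝ (Fin N)) (δ r F : ℝ), IsWeakSubsolution s U (fun _ => F) w →
      Measurable w → 0 < δ → δ ≤ 1 → 0 < r → ball x₀ r ⊆ U → 0 ≤ F →
      essSup (fun x => ENNReal.ofReal (w x)) (volume.restrict (ball x₀ (r / 2)))
        ≤ ENNReal.ofReal C *
          (ENNReal.ofReal δ * nonlocalTail s (fun x => (w x)⁺) x₀ (r / 2)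
            + ENNReal.ofReal (δ * r ^ (2 * s)) * ENNReal.ofReal F
            + ENNReal.ofReal ((1 / δ) ^ ((N : ℝ) / (4 * s))) *
              (⨍⁻ x in ball x₀ r, ENNReal.ofReal ((w x)⁺ ^ 2) ∂volume) ^ (1 / 2 : ℝ)) := by
  obtain ⟨θ, hθ, H⟩ := exists_ae_le_of_nonlocalTail_le (N := N) hs0 hs1
  refine ⟨max 1 (√θ)⁻¹, by positivity, fun U w x₀ δ r F hw hwm hδ hδ1 hr hU hF => ?_⟩
  set d : ℝ := (1 / δ) ^ ((N : ℝ) / (4 * s)) with hd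
  set T := ENNReal.ofReal δ * nonlocalTail s (fun x => (w x)⁺) x₀ (r / 2)
  set a := ⨍⁻ x in ball x₀ r, ENNReal.ofReal ((w x)⁺ ^ 2) ∂volume
  have hd2 : ((√θ)⁻¹ * d) ^ 2 = (θ * δ ^ (N / (2 * s)))⁻¹ := by
    rw [mul_pow, inv_pow, Real.sq_sqrt hθ.le, mul_inv, hd, one_div, Real.inv_rpow hδ.le, inv_pow,
      ← Real.rpow_natCast, ← Real.rpow_mul hδ.le, Nat.cast_ofNat]
    congr 3
    field_simp
    norm_num
  refine le_of_forall_gt_imp_ge_of_dense fun b hb => ?_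
  obtain rfl | hb_top := eq_or_ne b ⊤
  · exact le_top
  obtain ⟨l, hl, rfl⟩ : ∃ l : ℝ, 0 < l ∧ ENNReal.ofReal l = b :=
    ⟨b.toReal, ENNReal.toReal_pos (bot_lt_of_lt hb).ne' hb_top, ENNReal.ofReal_toReal hb_top⟩
  have hterm {c : ℝ} {X : ℝ≥0∞} (hc : c ≤ max 1 (√θ)⁻¹)
      (hX : X ≤ T + ENNReal.ofReal (δ * r ^ (2 * s)) * ENNReal.ofReal F
        + ENNReal.ofReal d * a ^ (1 / 2 : ℝ)) : ENNReal.ofReal c * X ≤ ENNReal.ofReal l :=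
    (mul_le_mul' (ENNReal.ofReal_le_ofReal hc) hX).trans hb.le
  have hT := hterm (le_max_left _ _) (le_self_add.trans le_self_add)
  have hF' := hterm (le_max_left _ _) (le_add_self.trans le_self_add)
  have ha := hterm (le_max_right _ _) le_add_self
  rw [ENNReal.ofReal_one, one_mul] at hT hF'
  rw [← ENNReal.ofReal_mul (by positivity), ENNReal.ofReal_le_ofReal_iff hl.le] at hF'
  rw [← mul_assoc, ← ENNReal.ofReal_mul (by positivity)] at ha
  have ha' := le_ofReal_of_ofReal_mul_rpow_half_le (by positivity) hl.le ha
  rw [div_pow, hd2, div_inv_eq_mul, mul_comm] at ha'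
  refine essSup_le_of_ae_le _ ?_
  filter_upwards [H U w x₀ δ r F l hw hwm hδ hδ1 hr hU hF hl hT hF' ha'] with x hx
  exact ENNReal.ofReal_le_ofReal hx

end LocalBoundedness

theorem ball_subset_of_le_infEDist_frontier {E : Type*} [SeminormedAddCommGroup E]
    [NormedSpace ℝ E] {U : Set E} (hU : IsOpen U) {x : E} (hx : x ∈ U) {r : ℝ} (hr0 : 0 < r)
    (hr : ENNReal.ofReal r ≤ infEDist x (frontier U)) : ball x r ⊆ U := by
  have hdisj : Disjoint (ball x r) (frontier U) := by
    refine Set.disjoint_left.2 fun y hy hyU =>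
      (infEDist_le_edist_of_mem (x := x) hyU).not_gt ?_
    rw [edist_comm, edist_dist]
    exact ((ENNReal.ofReal_lt_ofReal_iff hr0).2 hy).trans_le hr
  refine (convex_ball x r).isPreconnected.subset_left_of_subset_union hU
    isClosed_closure.isOpen_compl (disjoint_compl_right.mono_left subset_closure) (fun y hy => ?_)
    ⟨x, mem_ball_self hr0, hx⟩
  refine or_iff_not_imp_left.2 fun hyU hyc => Set.disjoint_left.1 hdisj hy ?_
  exact hU.frontier_eq ▸ ⟨hyc, hyU⟩

theorem IsWeakSubsolution.const_rhs {N : ℕ} {s : ℝ} {U : Set (EuclideanSpace ℝ (Fin N))}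
    {f w : EuclideanSpace ℝ (Fin N) → ℝ} (hw : IsWeakSubsolution s U f w)
    (hf : MemLp f ∞ (volume.restrict U)) :
    IsWeakSubsolution s U (fun _ => (eLpNorm f ∞ (volume.restrict U)).toReal) w := by
  refine hw.mono_rhs hf (memLp_top_const _) ?_
  filter_upwards [ae_le_eLpNormEssSup (f := f) (μ := volume.restrict U)] with x hx
  refine (Real.le_norm_self _).trans ?_
  rw [← toReal_enorm, eLpNorm_exponent_top]
  exact ENNReal.toReal_mono (eLpNorm_exponent_top (f := f) ▸ hf.2.ne) hx

theorem mainTheorem11_general (N : ℕ) (hN : 1 ≤ N) (s : ℝ) (hs0 : 0 < s) (hs1 : s < 1) :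
    ∃ C : ℝ, 0 < C ∧
      ∀ (U : Set (EuclideanSpace ℝ (Fin N))) (x₀ : EuclideanSpace ℝ (Fin N))
        (δ : ℝ) (_hδ0 : 0 < δ) (_hδ1 : δ ≤ 1)
        (r : ℝ) (_hr0 : 0 < r) (_hr : ball x₀ r ⊆ U)
        (f : EuclideanSpace ℝ (Fin N) → ℝ) (_hf : MemLp f ∞ (volume.restrict U))
        (w : EuclideanSpace ℝ (Fin N) → ℝ) (_hw : IsWeakSubsolution s U f w),
        essSup (fun x => ENNReal.ofReal (w x)) (volume.restrict (ball x₀ (r / 2))) ≤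
          ENNReal.ofReal C *
            (ENNReal.ofReal δ * nonlocalTail s (fun x => (w x)⁺) x₀ (r / 2)
              + ENNReal.ofReal (δ * r ^ (2 * s)) * eLpNorm f ∞ (volume.restrict U)
              + ENNReal.ofReal ((1 / δ) ^ ((N : ℝ) / (4 * s))) *
                (⨍⁻ x in ball x₀ r, ENNReal.ofReal ((w x)⁺ ^ 2) ∂volume) ^ (1 / 2 : ℝ)) := by
  have : NeZero N := ⟨by omega⟩
  obtain ⟨C, hC, H⟩ := exists_essSup_le_of_measurable (N := N) hs0 hs1
  refine ⟨C, hC, fun U x₀ δ hδ0 hδ1 r hr0 hr f hf w hw => ?_⟩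
  have hmeas := hw.1.aemeasurable
  have hmk := hmeas.ae_eq_mk
  have hbound := H U (hmeas.mk w) x₀ δ r _ ((hw.const_rhs hf).congr_ae hmk) hmeas.measurable_mk
    hδ0 hδ1 hr0 hr ENNReal.toReal_nonneg
  have hess : essSup (fun x => ENNReal.ofReal (w x)) (volume.restrict (ball x₀ (r / 2)))
      = essSup (fun x => ENNReal.ofReal (hmeas.mk w x)) (volume.restrict (ball x₀ (r / 2))) :=
    essSup_congr_ae (hmk.restrict.fun_comp ENNReal.ofReal)
  have htail : nonlocalTail s (fun x => (hmeas.mk w x)⁺) x₀ (r / 2)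
      ≤ nonlocalTail s (fun x => (w x)⁺) x₀ (r / 2) :=
    nonlocalTail_mono (hmk.mono fun x hx => (congrArg (|·⁺|) hx).ge) x₀ (r / 2)
  have hmean : ⨍⁻ x in ball x₀ r, ENNReal.ofReal ((hmeas.mk w x)⁺ ^ 2) ∂volume
      = ⨍⁻ x in ball x₀ r, ENNReal.ofReal ((w x)⁺ ^ 2) ∂volume :=
    laverage_congr (hmk.symm.restrict.fun_comp fun t => ENNReal.ofReal (t⁺ ^ 2))
  rw [ENNReal.ofReal_toReal hf.2.ne, hmean] at hbound
  rw [hess]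
  refine hbound.trans ?_
  gcongr

theorem mainTheorem11 (N : ℕ) (hN : 1 ≤ N) (s : ℝ) (hs0 : 0 < s) (hs1 : s < 1) :
    ∃ C : ℝ, 0 < C ∧
      ∀ (U : Set (EuclideanSpace ℝ (Fin N))) (_hU : IsOpen U)
        (x₀ : EuclideanSpace ℝ (Fin N)) (_hx₀ : x₀ ∈ U)
        (δ : ℝ) (_hδ0 : 0 < δ) (_hδ1 : δ ≤ 1)
        (r : ℝ) (_hr0 : 0 < r) (_hr : ENNReal.ofReal r < infEDist x₀ (frontier U))
        (f : EuclideanSpace ℝ (Fin N) → ℝ) (_hf : MemLp f ∞ (volume.restrict U))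
        (w : EuclideanSpace ℝ (Fin N) → ℝ) (_hw : IsWeakSubsolution s U f w)
        (_hw0 : ∀ᵐ x ∂(volume.restrict U), 0 ≤ w x),
        essSup (fun x => ENNReal.ofReal (w x)) (volume.restrict (ball x₀ (r / 2))) ≤
          ENNReal.ofReal C *
            (ENNReal.ofReal δ * nonlocalTail s w x₀ (r / 2)
              + ENNReal.ofReal (δ * r ^ (2 * s)) * eLpNorm f ∞ (volume.restrict U)
              + ENNReal.ofReal ((1 / δ) ^ ((N : ℝ) / (4 * s))) *
                (⨍⁻ x in ball x₀ r, ENNReal.ofReal (w x ^ 2) ∂volume) ^ (1 / 2 : ℝ)) := by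
  obtain ⟨C, hC, H⟩ := mainTheorem11_general N hN s hs0 hs1
  refine ⟨C, hC, fun U hU x₀ hx₀ δ hδ0 hδ1 r hr0 hr f hf w hw _ =>
    (H U x₀ δ hδ0 hδ1 r hr0 (ball_subset_of_le_infEDist_frontier hU hx₀ hr0 hr.le) f hf w hw).trans
      ?_⟩
  have habs (x : EuclideanSpace ℝ (Fin N)) : |(w x)⁺| ≤ |w x| := by
    rw [abs_of_nonneg (posPart_nonneg _)]
    exact max_le (le_abs_self _) (abs_nonneg _)
  gcongr (_ * (_ * ?_ + _ + _ * ?_ ^ _))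
  · exact nonlocalTail_mono (Eventually.of_forall habs) x₀ (r / 2)
  · exact lintegral_mono fun x => ENNReal.ofReal_le_ofReal (sq_le_sq.2 (habs x))
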